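/- Let $n\ge 3$, let $M$ be a compact smooth manifold with boundary $\Sigma=\partial M$ and interior $M_+$, of dimension $d=n+1$, with a Riemannian conformal structure $[g]$ that is smooth up to $\Sigma$. Let $\boldsymbol g$ be the conformal metric, $\mathcal E[w]$ ($w\in\mathbb R$) the bundle of conformal densities of weight $w$, and let $\sigma\in\mathcal E[1]$ make $M$ Poincaré–Einstein: $\sigma>0$ on $M_+$, $\sigma=0$ and $\nabla\sigma\neq0$ along $\Sigma$, and the metric $g_+=\sigma^{-2}\boldsymbol g$ on $M_+$ satisfies $\operatorname{Ric}(g_+)=-n\,g_+$. For a metric $g$ in the conformal class write $\nabla$ for the Levi-Civita connection, coupled to the flat connection on densities given by the trivialisation by $g$ (and to the tractor connection on tractors), $\Delta=-\nabla^a\nabla_a$, and $J$ for the trace of the Schouten tensor $P$, where $\operatorname{Ric}=(d-2)P+Jg$. In the scale $g$ a standard tractor is a triple $(\sigma,\mu_a,\rho)\in\mathcal E[1]\oplus\mathcal E_a[1]\oplus\mathcal E[-1]$. The tractor metric is $h(U,U)=2\sigma\rho+\mu^a\mu_a$, the tractor connection is $\nabla_a(\sigma,\mu_b,\rho)=(\nabla_a\sigma-\mu_a,\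 \nabla_a\mu_b+\boldsymbol g_{ab}\rho+P_{ab}\sigma,\ \nabla_a\rho-P_{ac}\mu^c)$, and under $g\mapsto\Omega^2g$, with $\Upsilon=d\log\Omega$, the triple becomes $(\sigma,\ \mu+\Upsilon\sigma,\ \rho-\Upsilon\cdot\mu-\tfrac12|\Upsilon|^2\sigma)$. On fields $u$ of weight $w$ let $$D_Au=\big((d+2w-2)w\,u,\ (d+2w-2)\nabla_a u,\ \Delta u-wJu\big),\qquad I_A=\tfrac1d D_A\sigma .$$ Then the following hold for every $w\in\mathbb R$, with $s:=n+w$. 1. (Conformal invariance.) For smooth $u\in\mathcal E[w]$ on an open set $U\subset M$ and two metrics of the conformal class on $U$, the triples $D_Au$ computed from the two metrics are related by the tractor transformation rule with weight $w-1$; and $I^AD_Au$, computed from any metric of the class, is the same density of weight $w-1$. 2. (Scattering Laplacian.) For smooth $u\in\mathcal E[w]$ on an open set $U\subset M$, on $U\cap M_+$ we have $$\sigma\, I^AD_A u=\big(\Delta^{g_+}-s(n-s)\big)u ,$$ where $\Delta^{g_+}$ acts on densities through the trivialisation of $\mathcal E[w]$ by $g_+$. 3. (Robin operator.) Along $\Sigma$,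 for every smooth field $u$ of weight $w$ defined near a point of $\Sigma$, either a density or a section of a tensor power of the tractor bundle tensored with $\mathcal E[w]$, $$I^AD_Au=(d+2w-2)\,\delta u,\qquad \delta u=n^a\nabla_au-wH\,u ,$$ where $n_a\in\mathcal E_a[1]$ is the unit conormal of $\Sigma$ that is positive on inward pointing vectors, extended smoothly off $\Sigma$ in any way, and $H=\frac1{d-1}(\nabla_an^a-n^an^b\nabla_an_b)$ is the mean curvature. In particular, for $w\ne1-\frac d2$ the operator $I^AD_A$ is along $\Sigma$ a non-zero constant multiple of the conformal Robin operator $\delta$. -/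

import Mathlib

open Set Filter Topology Bundle
open scoped Manifold ContDiff

noncomputable section

namespace PoincareEinstein

/-! ### Conformal structures and densities

`M` is a smooth manifold with boundary of dimension `d = n + 1`. -/

/-- The model vector space `ℝ^(n+1)`. -/
abbrev Model (n : ℕ) : Type := EuclideanSpace ℝ (Fin (n + 1))

/-- Bilinear forms on the tangent space at `p`. -/
abbrev Bil (n : ℕ) {M : Type*} [TopologicalSpace M]
    [ChartedSpace (EuclideanHalfSpace (n + 1)) M] (p : M) : Type :=
  TangentSpace (𝓡∂ (n + 1)) p →L[ℝ] TangentSpace (𝓡∂ (n + 1)) p →L[ℝ] ℝ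

/-- A (Riemannian) conformal structure: a smooth ray subbundle `Q` of `S²T*M` whose fibre at `p`
consists of conformally related inner products. -/
structure ConformalStructure (n : ℕ) (M : Type*) [TopologicalSpace M]
    [ChartedSpace (EuclideanHalfSpace (n + 1)) M] [IsManifold (𝓡∂ (n + 1)) ∞ M] where
  Q : ∀ p : M, Set (Bil n p)
  exists_metric : ∃ g : ContMDiffRiemannianMetric (𝓡∂ (n + 1)) ∞ (Model n)
      (fun p : M => TangentSpace (𝓡∂ (n + 1)) p),
    ∀ (p : M) (h : Bil n p), h ∈ Q p ↔ ∃ t : ℝ, 0 < t ∧ h = t • g.inner p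

variable {n : ℕ} {M : Type*} [TopologicalSpace M]
  [ChartedSpace (EuclideanHalfSpace (n + 1)) M] [IsManifold (𝓡∂ (n + 1)) ∞ M]

/-- A scale over `U`: a smooth metric on `U` belonging to the conformal structure, i.e. a smooth
section of `Q` over `U`.  (Values outside `U` are irrelevant.) -/
def IsScaleOn (c : ConformalStructure n M) (U : Set M) (g : ∀ p : M, Bil n p) : Prop :=
  (∀ p ∈ U, g p ∈ c.Q p) ∧
  ContMDiffOn (𝓡∂ (n + 1)) ((𝓡∂ (n + 1)).prod 𝓘(ℝ, Model n →L[ℝ] Model n →L[ℝ] ℝ)) ∞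
    (fun p => TotalSpace.mk' (Model n →L[ℝ] Model n →L[ℝ] ℝ)
      (E := fun p : M => TangentSpace (𝓡∂ (n + 1)) p →L[ℝ] TangentSpace (𝓡∂ (n + 1)) p →L[ℝ] ℝ)
      p (g p)) U

/-- A smooth conformal density of weight `w` over `U`, a section of `ℰ[w]`.  As `ℰ[w]` is associated
to the `ℝ₊`-bundle `Q` by `t ↦ t^(-w/2)`, its sections are the functions on `Q` that are
homogeneous of degree `w/2`: `f(p, t h) = t^(w/2) f(p, h)`. -/
structure Density (c : ConformalStructure n M) (U : Set M) (w : ℝ) where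
  toFun : ∀ p : M, Bil n p → ℝ
  homog : ∀ p ∈ U, ∀ h ∈ c.Q p, ∀ t : ℝ, 0 < t → toFun p (t • h) = t ^ (w / 2) * toFun p h
  smooth : ∀ g : ∀ p : M, Bil n p, IsScaleOn c U g →
    ContMDiffOn (𝓡∂ (n + 1)) 𝓘(ℝ, ℝ) ∞ (fun p => toFun p (g p)) U

/-- The function that represents the density `u` in the scale `g`. -/
def Density.inScale {c : ConformalStructure n M} {U : Set M} {w : ℝ} (u : Density c U w)
    (g : ∀ p : M, Bil n p) (p : M) : ℝ := u.toFun p (g p)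

/-- The function that represents the density `u` in the scale `g`, read in the chart at `x`. -/
def Density.inChart {c : ConformalStructure n M} {U : Set M} {w : ℝ} (u : Density c U w)
    (g : ∀ p : M, Bil n p) (x : M) (y : Model n) : ℝ :=
  u.inScale g ((extChartAt (𝓡∂ (n + 1)) x).symm y)

/-- `g₊` is the metric `σ⁻² 𝐠` on `U`: the metric of the conformal structure for which the weight
one density `σ` is represented by the constant function `1`. -/
def IsMetricOf {c : ConformalStructure n M} (σ : Density c univ 1) (U : Set M)
    (gp : ∀ p : M, Bil n p) : Prop :=
  ∀ p ∈ U, gp p ∈ c.Q p ∧ σ.inScale gp p = 1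

/-! ### Riemannian geometry in a chart

All fields are functions on the model space, near a point of the closed half-space; a metric is
given by its matrix `G y i j = g_ij(y)`. -/

/-- The `i`-th partial derivative (one-sided at the boundary of the half-space). -/
def pd {W : Type*} [NormedAddCommGroup W] [NormedSpace ℝ W] (i : Fin (n + 1)) (f : Model n → W)
    (y : Model n) : W :=
  fderivWithin ℝ f (range (𝓡∂ (n + 1))) y (EuclideanSpace.single i 1)

/-- The matrix `g_ij` of `g` in the coordinate frame of the chart at `x`. -/
def metricMat (g : ∀ p : M, Bil n p) (x : M) (y : Model n) :
    Matrix (Fin (n + 1)) (Fin (n + 1)) ℝ :=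
  Matrix.of fun i j =>
    let frame : Model n →L[ℝ] TangentSpace (𝓡∂ (n + 1)) ((extChartAt (𝓡∂ (n + 1)) x).symm y) :=
      mfderivWithin 𝓘(ℝ, Model n) (𝓡∂ (n + 1)) (extChartAt (𝓡∂ (n + 1)) x).symm
        (range (𝓡∂ (n + 1))) y
    g ((extChartAt (𝓡∂ (n + 1)) x).symm y)
      (frame (EuclideanSpace.single i 1)) (frame (EuclideanSpace.single j 1))

/-- Christoffel symbols `Γ^k_ij` of the Levi-Civita connection. -/
def christoffel (G : Model n → Matrix (Fin (n + 1)) (Fin (n + 1)) ℝ) (y : Model n)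
    (k i j : Fin (n + 1)) : ℝ :=
  (1 / 2) * ∑ l, (G y)⁻¹ k l *
    (pd i (fun z => G z j l) y + pd j (fun z => G z i l) y - pd l (fun z => G z i j) y)

/-- The curvature `R_ab^c_d`, where `(∇_a ∇_b - ∇_b ∇_a) V^c = R_ab^c_d V^d`. -/
def riemann (G : Model n → Matrix (Fin (n + 1)) (Fin (n + 1)) ℝ) (y : Model n)
    (a b c d : Fin (n + 1)) : ℝ :=
  pd a (fun z => christoffel G z c b d) y - pd b (fun z => christoffel G z c a d) y
    + ∑ e, (christoffel G y c a e * christoffel G y e b d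
      - christoffel G y c b e * christoffel G y e a d)

/-- The Ricci tensor `Ric_ab = R_ca^c_b`. -/
def ricci (G : Model n → Matrix (Fin (n + 1)) (Fin (n + 1)) ℝ) (y : Model n)
    (a b : Fin (n + 1)) : ℝ :=
  ∑ c, riemann G y c a c b

/-- The trace `J` of the Schouten tensor; tracing `Ric = (d - 2) P + J g` gives
`Sc = 2 (d - 1) J = 2 n J`. -/
def schoutenTrace (G : Model n → Matrix (Fin (n + 1)) (Fin (n + 1)) ℝ) (y : Model n) : ℝ :=
  (∑ a, ∑ b, (G y)⁻¹ a b * ricci G y a b) / (2 * (n : ℝ))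

/-- The Schouten tensor `P_ab`, determined by `Ric = (d - 2) P + J g`, where `d - 2 = n - 1`. -/
def schouten (G : Model n → Matrix (Fin (n + 1)) (Fin (n + 1)) ℝ) (y : Model n)
    (a b : Fin (n + 1)) : ℝ :=
  (ricci G y a b - schoutenTrace G y * G y a b) / ((n : ℝ) - 1)

/-! ### Coupled derivatives

A vector bundle with connection, trivialised over the chart, is given by its fibre `W` and its
connection form `A y i : W → W`, so that `∇_i V = ∂_i V + A_i V`.  The bundle `ℰ[w]`, with the
connection of the trivialisation given by the scale, is `W = ℝ`, `A = 0`; tensoring another bundle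
with `ℰ[w]` does not change its connection form in the scale. -/

section Coupled

variable {W : Type*} [NormedAddCommGroup W] [NormedSpace ℝ W]

/-- The coupled derivative `∇_i V`. -/
def covD (A : Model n → Fin (n + 1) → W → W) (i : Fin (n + 1)) (V : Model n → W)
    (y : Model n) : W :=
  pd i V y + A y i (V y)

/-- The second coupled Levi-Civita derivative `∇_i ∇_j V`. -/
def hess (G : Model n → Matrix (Fin (n + 1)) (Fin (n + 1)) ℝ)
    (A : Model n → Fin (n + 1) → W → W) (i j : Fin (n + 1)) (V : Model n → W)
    (y : Model n) : W :=
  covD A i (covD A j V) y - ∑ k, christoffel G y k i j • covD A k V y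

/-- The (positive) Laplacian `Δ V = -g^ij ∇_i ∇_j V`. -/
def laplacian (G : Model n → Matrix (Fin (n + 1)) (Fin (n + 1)) ℝ)
    (A : Model n → Fin (n + 1) → W → W) (V : Model n → W) (y : Model n) : W :=
  -∑ i, ∑ j, (G y)⁻¹ i j • hess G A i j V y

end Coupled

/-! ### Tractors

In a scale `g` and a chart, a standard tractor is a triple `(σ, μ_a, ρ)`. -/

/-- Indices for the slots of a tractor: top, middle (`d = n + 1` of them), bottom. -/
abbrev TIdx (n : ℕ) : Type := Unit ⊕ Fin (n + 1) ⊕ Unit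

/-- The tractor, with coefficients in `W`, that has the given slots. -/
def slots {W : Type*} (top : W) (mid : Fin (n + 1) → W) (bot : W) : TIdx n → W :=
  Sum.elim (fun _ => top) (Sum.elim mid (fun _ => bot))

def topSlot {W : Type*} (U : TIdx n → W) : W := U (Sum.inl ())
def midSlot {W : Type*} (U : TIdx n → W) (a : Fin (n + 1)) : W := U (Sum.inr (Sum.inl a))
def botSlot {W : Type*} (U : TIdx n → W) : W := U (Sum.inr (Sum.inr ()))

/-- The contraction `h_AB U^A V^B` of a tractor with a `W`-valued tractor by the tractor metric;
`G` is the matrix of `g` at the point. -/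
def tractorPair {W : Type*} [AddCommGroup W] [Module ℝ W]
    (G : Matrix (Fin (n + 1)) (Fin (n + 1)) ℝ) (U : TIdx n → ℝ) (V : TIdx n → W) : W :=
  topSlot U • botSlot V + botSlot U • topSlot V
    + ∑ a, ∑ b, (G⁻¹ a b * midSlot U a) • midSlot V b

/-- The change of the slots of a tractor under `g ↦ Ω² g`, where `G` is the matrix of `g` and `Υ` is
the differential of `log Ω` at the point: `(σ, μ, ρ)` becomes
`(Ω σ, Ω (μ + Υ σ), Ω⁻¹ (ρ - Υ·μ - |Υ|² σ / 2))`; the powers of `Ω` are the weights of the slots. -/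
def tractorChange (G : Matrix (Fin (n + 1)) (Fin (n + 1)) ℝ) (Ω : ℝ) (Υ : Fin (n + 1) → ℝ)
    (U : TIdx n → ℝ) : TIdx n → ℝ :=
  slots (Ω * topSlot U)
    (fun a => Ω * (midSlot U a + Υ a * topSlot U))
    (Ω⁻¹ * (botSlot U - ∑ a, ∑ b, G⁻¹ a b * Υ a * midSlot U b
      - (1 / 2) * (∑ a, ∑ b, G⁻¹ a b * Υ a * Υ b) * topSlot U))

/-- The connection form of the tractor connection:
`∇_a (σ, μ_b, ρ) = (∇_a σ - μ_a, ∇_a μ_b + g_ab ρ + P_ab σ, ∇_a ρ - P_ac μ^c)`. -/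
def tractorForm (G : Model n → Matrix (Fin (n + 1)) (Fin (n + 1)) ℝ) (y : Model n)
    (a : Fin (n + 1)) (U : TIdx n → ℝ) : TIdx n → ℝ :=
  slots (-midSlot U a)
    (fun b => -∑ k, christoffel G y k a b * midSlot U k
      + G y a b * botSlot U + schouten G y a b * topSlot U)
    (-∑ b, ∑ k, schouten G y a b * (G y)⁻¹ b k * midSlot U k)

/-- The connection form on the `k`-th tensor power of the tractor bundle, with components
`V^{A₁ ⋯ A_k}`, induced from the tractor connection. -/
def tensorForm (k : ℕ) (G : Model n → Matrix (Fin (n + 1)) (Fin (n + 1)) ℝ) (y : Model n)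
    (a : Fin (n + 1)) (V : (Fin k → TIdx n) → ℝ) : (Fin k → TIdx n) → ℝ :=
  fun α => ∑ m, tractorForm G y a (fun B => V (Function.update α m B)) (α m)

section Operators

variable {W : Type*} [NormedAddCommGroup W] [NormedSpace ℝ W]

/-- The Thomas operator `D_A V = (d+2w-2) w Y_A V + (d+2w-2) Z_A^a ∇_a V + X_A (Δ - w J) V` on
fields of weight `w`, as a tractor with coefficients in `W`. -/
def thomasD (G : Model n → Matrix (Fin (n + 1)) (Fin (n + 1)) ℝ)
    (A : Model n → Fin (n + 1) → W → W) (w : ℝ) (V : Model n → W) (y : Model n) : TIdx n → W :=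
  slots ((((n : ℝ) + 1 + 2 * w - 2) * w) • V y)
    (fun a => ((n : ℝ) + 1 + 2 * w - 2) • covD A a V y)
    (laplacian G A V y - (w * schoutenTrace G y) • V y)

/-- The tractor `I_A = (1/d) D_A σ` of a weight one density, represented by the function `s`. -/
def scaleTractor (G : Model n → Matrix (Fin (n + 1)) (Fin (n + 1)) ℝ) (s : Model n → ℝ)
    (y : Model n) : TIdx n → ℝ :=
  (1 / ((n : ℝ) + 1)) • thomasD G (fun _ _ _ => 0) 1 s y

/-- The operator `I^A D_A` on fields of weight `w`. -/
def scaleDotD (G : Model n → Matrix (Fin (n + 1)) (Fin (n + 1)) ℝ) (s : Model n → ℝ)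
    (A : Model n → Fin (n + 1) → W → W) (w : ℝ) (V : Model n → W) (y : Model n) : W :=
  tractorPair (G y) (scaleTractor G s y) (thomasD G A w V y)

/-- `∇_i ν_j` for a covector field `ν`. -/
def covCovector (G : Model n → Matrix (Fin (n + 1)) (Fin (n + 1)) ℝ)
    (ν : Model n → Fin (n + 1) → ℝ) (y : Model n) (i j : Fin (n + 1)) : ℝ :=
  pd i (fun z => ν z j) y - ∑ k, christoffel G y k i j * ν y k

/-- The mean curvature `H = (1/(d-1)) (∇_a ν^a - ν^a ν^b ∇_a ν_b)` of the boundary, where `ν` is a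
unit conormal along the boundary, extended arbitrarily off it. -/
def meanCurvature (G : Model n → Matrix (Fin (n + 1)) (Fin (n + 1)) ℝ)
    (ν : Model n → Fin (n + 1) → ℝ) (y : Model n) : ℝ :=
  (1 / (n : ℝ)) * (∑ i, ∑ j, (G y)⁻¹ i j * covCovector G ν y i j
    - ∑ i, ∑ j, ((∑ a, (G y)⁻¹ i a * ν y a) * (∑ b, (G y)⁻¹ j b * ν y b)
      * covCovector G ν y i j))

/-- The conformal Robin operator `δ V = ν^a ∇_a V - w H V` on fields of weight `w`. -/
def robin (G : Model n → Matrix (Fin (n + 1)) (Fin (n + 1)) ℝ)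
    (A : Model n → Fin (n + 1) → W → W) (w : ℝ) (ν : Model n → Fin (n + 1) → ℝ)
    (V : Model n → W) (y : Model n) : W :=
  ∑ a, ∑ b, ((G y)⁻¹ a b * ν y a) • covD A b V y - (w * meanCurvature G ν y) • V y

end Operators

/-- The covector field `ν` is smooth near `y` and, along the boundary of the half-space near `y`, is
the unit conormal that is positive on inward pointing vectors. -/
def IsUnitConormalNear (G : Model n → Matrix (Fin (n + 1)) (Fin (n + 1)) ℝ)
    (ν : Model n → Fin (n + 1) → ℝ) (y : Model n) : Prop :=
  (∀ᶠ z in 𝓝[range (𝓡∂ (n + 1))] y, ContDiffWithinAt ℝ ∞ ν (range (𝓡∂ (n + 1))) z) ∧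
  ∀ᶠ z in 𝓝[range (𝓡∂ (n + 1))] y, z 0 = 0 →
    0 < ν z 0 ∧ (∀ i, i ≠ 0 → ν z i = 0) ∧ ∑ a, ∑ b, (G z)⁻¹ a b * ν z a * ν z b = 1

/-! ### Poincaré–Einstein structures -/

/-- The weight one density `σ` makes the manifold with boundary `M`, with its conformal structure, a
Poincaré–Einstein manifold: `σ` is a defining density for the boundary, positive in the interior,
and the metric `g₊ = σ⁻² 𝐠` on the interior satisfies `Ric(g₊) = -n g₊`. -/
structure IsPoincareEinstein (c : ConformalStructure n M) (σ : Density c univ 1) : Prop where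
  pos : ∀ p ∈ (𝓡∂ (n + 1)).interior M, ∀ h ∈ c.Q p, 0 < σ.toFun p h
  zero : ∀ p ∈ (𝓡∂ (n + 1)).boundary M, ∀ h ∈ c.Q p, σ.toFun p h = 0
  nondegenerate : ∀ g : ∀ p : M, Bil n p, IsScaleOn c univ g →
    ∀ p ∈ (𝓡∂ (n + 1)).boundary M, mfderiv (𝓡∂ (n + 1)) 𝓘(ℝ, ℝ) (σ.inScale g) p ≠ 0
  einstein : ∀ gp : ∀ p : M, Bil n p, IsMetricOf σ ((𝓡∂ (n + 1)).interior M) gp →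
    ∀ x : M, ∀ p ∈ (𝓡∂ (n + 1)).interior M ∩ (extChartAt (𝓡∂ (n + 1)) x).source,
      ∀ i j, ricci (metricMat gp x) (extChartAt (𝓡∂ (n + 1)) x p) i j
        = -(n : ℝ) * metricMat gp x (extChartAt (𝓡∂ (n + 1)) x p) i j

end PoincareEinstein

end

namespace PoincareEinstein

noncomputable section

/-! ### One-sided calculus on relatively open subsets of the half-space. -/

section HalfSpaceCalculus

variable {n : ℕ}

section PartialDerivatives

variable {W : Type*} [NormedAddCommGroup W] [NormedSpace ℝ W]

/-! Everything is checked in coordinates, on a relatively open set `K` of the closed half-space on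
which two scales are related by g' = e^(2φ) g; write Υ = dφ and d = n + 1.

Conformal invariance. The Christoffel symbols change by the algebraic expression `conformalDiff` in
Υ (`christoffel_eq`). This gives the change of divergences (`divergence_eq`), of the Ricci tensor
(`ricci_eq`) and, after tracing, of J: J' = e^(-2φ) (J - ∇·Υ - ((d-2)/2)|Υ|²). In Δu - wJu the
second derivatives of φ cancel, and what remains is exactly the tractor transformation rule
(`thomasD_eq`). That rule preserves the tractor metric, and I is itself D of a density up to a
constant, so I·D is covariant (`scaleDotD_eq`).

Scattering. By covariance I·D may be computed in the scale g₊, in which σ = 1. The Einstein equation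
gives J = -d/2 there, so I = (1, 0, 1/2) and I·Du = Δu + w(n+w)u, which is Δu - s(n-s)u
(`scaleDotD_of_einstein`). Returning to the scale g costs only powers of σ
(`IsPoincareEinstein.scattering`).

Robin operator. The same computation for u = σ gives I·Dσ = d, that is |I|² = 1, in the interior.
Written out, |dσ|² = 1 + (2/d) σ (∇·dσ + Jσ). Both sides are smooth up to Σ, so the identity holds
there too by continuity. Hence dσ is the unit conormal along Σ, and the first derivative of the
identity yields σ^a σ^b ∇_a σ_b = (∇·dσ)/d, where σ_a = ∇_a σ. It follows that H = (∇·dσ)/d and that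
I = (0, n_a, -H) along Σ. As the top slot of I vanishes, the Laplacian in Du drops out of I·Du, and
(d+2w-2)(∇_n u - wHu) is left, whatever bundle with connection u takes values in
(`scaleDotD_eq_robin`). H does not depend on how the conormal is extended (`meanCurvature_congr`).
-/

theorem uniqueDiffOn_range : UniqueDiffOn ℝ (range (𝓡∂ (n + 1))) :=
  (𝓡∂ (n + 1)).uniqueDiffOn

/-- `K` is relatively open in the closed half-space. -/
def IsRelOpen (K : Set (Model n)) : Prop :=
  K ⊆ range (𝓡∂ (n + 1)) ∧ ∀ z ∈ K, K ∈ 𝓝[range (𝓡∂ (n + 1))] z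

variable {K : Set (Model n)} {y : Model n}

theorem IsRelOpen.uniqueDiffOn (hK : IsRelOpen K) : UniqueDiffOn ℝ K := fun z hz =>
  (uniqueDiffOn_range z (hK.1 hz)).mono_nhds (by
    rw [nhdsWithin_le_iff]; exact hK.2 z hz)

/-- `K` and the half-space have the same germ at `y`. This lets `pd`, which is defined by the whole
half-space, be computed by the calculus of functions smooth on `K`. -/
theorem IsRelOpen.fderivWithin_eq (hK : IsRelOpen K) (hy : y ∈ K) (f : Model n → W) :
    fderivWithin ℝ f (range (𝓡∂ (n + 1))) y = fderivWithin ℝ f K y := by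
  refine fderivWithin_congr_set ?_
  filter_upwards [mem_nhdsWithin_iff_eventually.1 (hK.2 y hy)] with z hz
  exact propext ⟨hz, fun h => hK.1 h⟩

theorem IsRelOpen.differentiableWithinAt (hK : IsRelOpen K) {f : Model n → W}
    (hf : ContDiffOn ℝ ∞ f K) (hy : y ∈ K) :
    DifferentiableWithinAt ℝ f (range (𝓡∂ (n + 1))) y := by
  have h := ((hf y hy).differentiableWithinAt (by simp))
  exact (h.mono_of_mem_nhdsWithin (hK.2 y hy))

theorem IsRelOpen.pd_congr (hK : IsRelOpen K) {f g : Model n → W} (h : EqOn f g K) (hy : y ∈ K)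
    (i : Fin (n + 1)) : pd i f y = pd i g y := by
  unfold pd
  rw [hK.fderivWithin_eq hy, hK.fderivWithin_eq hy, fderivWithin_congr h (h hy)]

theorem IsRelOpen.contDiffOn_pd (hK : IsRelOpen K) {f : Model n → W} (hf : ContDiffOn ℝ ∞ f K)
    (i : Fin (n + 1)) : ContDiffOn ℝ ∞ (pd i f) K := by
  have h := (hf.fderivWithin hK.uniqueDiffOn (m := ∞) (by simp)).clm_apply
    (contDiffOn_const (c := EuclideanSpace.single i (1 : ℝ)))
  refine h.congr fun z hz => ?_
  unfold pd
  rw [hK.fderivWithin_eq hz]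

theorem pd_add {f g : Model n → W} (hy : y ∈ range (𝓡∂ (n + 1)))
    (hf : DifferentiableWithinAt ℝ f (range (𝓡∂ (n + 1))) y)
    (hg : DifferentiableWithinAt ℝ g (range (𝓡∂ (n + 1))) y) (i : Fin (n + 1)) :
    pd i (fun z => f z + g z) y = pd i f y + pd i g y := by
  unfold pd
  rw [fderivWithin_fun_add (uniqueDiffOn_range y hy) hf hg]
  rfl

theorem pd_sub {f g : Model n → W} (hy : y ∈ range (𝓡∂ (n + 1)))
    (hf : DifferentiableWithinAt ℝ f (range (𝓡∂ (n + 1))) y)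
    (hg : DifferentiableWithinAt ℝ g (range (𝓡∂ (n + 1))) y) (i : Fin (n + 1)) :
    pd i (fun z => f z - g z) y = pd i f y - pd i g y := by
  unfold pd
  rw [fderivWithin_fun_sub (uniqueDiffOn_range y hy) hf hg]
  rfl

theorem pd_mul {f g : Model n → ℝ} (hy : y ∈ range (𝓡∂ (n + 1)))
    (hf : DifferentiableWithinAt ℝ f (range (𝓡∂ (n + 1))) y)
    (hg : DifferentiableWithinAt ℝ g (range (𝓡∂ (n + 1))) y) (i : Fin (n + 1)) :
    pd i (fun z => f z * g z) y = pd i f y * g y + f y * pd i g y := by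
  unfold pd
  rw [fderivWithin_fun_mul (uniqueDiffOn_range y hy) hf hg]
  simp
  ring

theorem pd_const (c : W) (i : Fin (n + 1)) : pd i (fun _ => c) y = 0 := by
  unfold pd
  simp

theorem pd_const_mul {f : Model n → ℝ} (hy : y ∈ range (𝓡∂ (n + 1))) (c : ℝ)
    (hf : DifferentiableWithinAt ℝ f (range (𝓡∂ (n + 1))) y) (i : Fin (n + 1)) :
    pd i (fun z => c * f z) y = c * pd i f y := by
  rw [pd_mul hy (differentiableWithinAt_const c) hf, pd_const]
  ring

theorem pd_sum {ι : Type*} (s : Finset ι) {f : ι → Model n → W}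
    (hy : y ∈ range (𝓡∂ (n + 1)))
    (hf : ∀ k ∈ s, DifferentiableWithinAt ℝ (f k) (range (𝓡∂ (n + 1))) y) (i : Fin (n + 1)) :
    pd i (fun z => ∑ k ∈ s, f k z) y = ∑ k ∈ s, pd i (f k) y := by
  unfold pd
  rw [fderivWithin_fun_sum (uniqueDiffOn_range y hy) hf]
  simp

theorem pd_exp {f : Model n → ℝ} (hy : y ∈ range (𝓡∂ (n + 1)))
    (hf : DifferentiableWithinAt ℝ f (range (𝓡∂ (n + 1))) y) (i : Fin (n + 1)) :
    pd i (fun z => Real.exp (f z)) y = Real.exp (f y) * pd i f y := by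
  unfold pd
  rw [fderivWithin_exp hf (uniqueDiffOn_range y hy)]
  simp

end PartialDerivatives

theorem contDiffOn_det {m : Type*} [Fintype m] [DecidableEq m] {K : Set (Model n)}
    {G : Model n → Matrix m m ℝ}
    (hG : ∀ i j, ContDiffOn ℝ ∞ (fun z => G z i j) K) :
    ContDiffOn ℝ ∞ (fun z => (G z).det) K := by
  simp only [Matrix.det_apply']
  exact ContDiffOn.sum fun τ _ => contDiffOn_const.mul (contDiffOn_prod fun i _ => hG _ _)

/-- Cramer's rule: the entries are cofactors, which are determinants again, divided by the
determinant. -/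
theorem contDiffOn_inv_apply {m : Type*} [Fintype m] [DecidableEq m] {K : Set (Model n)}
    {G : Model n → Matrix m m ℝ} (hG : ∀ i j, ContDiffOn ℝ ∞ (fun z => G z i j) K)
    (hdet : ∀ z ∈ K, IsUnit (G z).det) (i j : m) :
    ContDiffOn ℝ ∞ (fun z => (G z)⁻¹ i j) K := by
  simp only [Matrix.inv_def, Ring.inverse_eq_inv', Matrix.smul_apply, smul_eq_mul,
    Matrix.adjugate_apply]
  refine ((contDiffOn_det hG).inv fun z hz => (hdet z hz).ne_zero).mul (contDiffOn_det fun a b => ?_)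
  by_cases h : a = j
  · subst h
    simp only [Matrix.updateRow_self]
    exact contDiffOn_const
  · simp only [Matrix.updateRow_ne h]
    exact hG a b

end HalfSpaceCalculus

/-! ### Algebra of the difference tensor of two conformal Levi-Civita connections. -/

section ConformalAlgebra

variable {ι : Type*} [DecidableEq ι]

/-- The difference of the Christoffel symbols of `e^(2φ) g` and `g`, where `φ` stands for the
differential of the function `φ` and `T` for its gradient. -/
def conformalDiff (g : Matrix ι ι ℝ) (φ T : ι → ℝ) (k i j : ι) : ℝ :=
  (if k = i then φ j else 0) + (if k = j then φ i else 0) - g i j * T k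

theorem conformalDiff_symm {g : Matrix ι ι ℝ} (hg : ∀ i j, g i j = g j i) (φ T : ι → ℝ)
    (k i j : ι) : conformalDiff g φ T k i j = conformalDiff g φ T k j i := by
  simp only [conformalDiff, hg i j]
  ring

variable [Fintype ι]

theorem sum_mul_conformalDiff (g : Matrix ι ι ℝ) (φ T X : ι → ℝ) (i j : ι) :
    ∑ k, X k * conformalDiff g φ T k i j
      = X i * φ j + X j * φ i - g i j * ∑ k, X k * T k := by
  simp only [conformalDiff, mul_sub, mul_add, Finset.sum_sub_distrib, Finset.sum_add_distrib,
    mul_ite, mul_zero, Finset.sum_ite_eq', Finset.mem_univ, if_true, Finset.mul_sum]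
  congr 1
  exact Finset.sum_congr rfl fun k _ => by ring

theorem sum_conformalDiff {g : Matrix ι ι ℝ} {φ T : ι → ℝ} (hT : ∀ i, ∑ k, g i k * T k = φ i)
    (hg : ∀ i j, g i j = g j i) (j : ι) :
    ∑ k, conformalDiff g φ T k k j = Fintype.card ι * φ j := by
  have h : ∀ k, g k j * T k = g j k * T k := fun k => by rw [hg]
  simp [conformalDiff, Finset.sum_add_distrib, h, hT]

/-- The change of the quadratic part of the Ricci curvature. -/
theorem sum_christoffel_add_conformalDiff {g : Matrix ι ι ℝ} {φ T : ι → ℝ} {Γ : ι → ι → ι → ℝ}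
    (hg : ∀ i j, g i j = g j i) (hΓ : ∀ k i j, Γ k i j = Γ k j i)
    (hT : ∀ i, ∑ k, g i k * T k = φ i) (b d : ι) :
    ∑ c, ∑ e, ((Γ c c e + conformalDiff g φ T c c e) * (Γ e b d + conformalDiff g φ T e b d)
        - (Γ c b e + conformalDiff g φ T c b e) * (Γ e c d + conformalDiff g φ T e c d))
      = ∑ c, ∑ e, (Γ c c e * Γ e b d - Γ c b e * Γ e c d)
        - g b d * (∑ c, ∑ e, Γ c c e * T e)
        + ((Fintype.card ι : ℝ) - 2) * ∑ e, Γ e b d * φ e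
        + ∑ c, (∑ e, g d e * Γ e b c) * T c + ∑ c, (∑ e, g b e * Γ e d c) * T c
        + ((Fintype.card ι : ℝ) - 2) * (φ b * φ d)
        - ((Fintype.card ι : ℝ) - 2) * (g b d * ∑ e, φ e * T e) := by
  set C := conformalDiff g φ T with hC
  set N : ℝ := (Fintype.card ι : ℝ)
  have hsum : ∀ j, ∑ k, C k k j = N * φ j := sum_conformalDiff hT hg
  have hX : ∀ (X : ι → ℝ) i j, ∑ k, X k * C k i j
      = X i * φ j + X j * φ i - g i j * ∑ k, X k * T k := fun X i j =>
    sum_mul_conformalDiff g φ T X i j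
  -- Expansion by degree in C: `h3`, `h4`, `h6`, `h7` are the linear terms, `h5` and `h8` the
  -- quadratic ones. The contracted symbols Γ^c_cb and Γ^c_cd of `h3` cancel against those of `h6`
  -- and `h7`.
  have h3 : ∑ c, ∑ e, Γ c c e * C e b d
      = (∑ c, Γ c c b) * φ d + (∑ c, Γ c c d) * φ b - g b d * ∑ c, ∑ e, Γ c c e * T e := by
    simp only [hX, Finset.sum_sub_distrib, Finset.sum_add_distrib, Finset.sum_mul,
      Finset.mul_sum]
  have h4 : ∑ c, ∑ e, C c c e * Γ e b d = N * ∑ e, Γ e b d * φ e := by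
    rw [Finset.sum_comm]
    simp only [← Finset.sum_mul, hsum, Finset.mul_sum]
    exact Finset.sum_congr rfl fun e _ => by ring
  have h5 : ∑ c, ∑ e, C c c e * C e b d
      = N * (2 * (φ b * φ d) - g b d * ∑ e, φ e * T e) := by
    rw [Finset.sum_comm]
    simp only [← Finset.sum_mul, hsum, mul_assoc, ← Finset.mul_sum, hX φ b d]
    ring
  have h6 : ∑ c, ∑ e, Γ c b e * C e c d
      = (∑ c, Γ c c b) * φ d + ∑ c, Γ c b d * φ c - ∑ c, (∑ e, g d e * Γ e b c) * T c := by
    simp only [hX, Finset.sum_sub_distrib, Finset.sum_add_distrib, Finset.sum_mul,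
      Finset.mul_sum]
    congr 1
    · congr 1
      exact Finset.sum_congr rfl fun c _ => by rw [hΓ c b c]
    · rw [Finset.sum_comm]
      exact Finset.sum_congr rfl fun c _ => Finset.sum_congr rfl fun e _ => by
        rw [hg e d]; ring
  have h7 : ∑ c, ∑ e, C c b e * Γ e c d
      = (∑ c, Γ c c d) * φ b + ∑ c, Γ c b d * φ c - ∑ c, (∑ e, g b e * Γ e d c) * T c := by
    rw [Finset.sum_comm]
    have h : ∀ e, ∑ c, C c b e * Γ e c d = Γ e b d * φ e + Γ e e d * φ b
        - g b e * ∑ c, Γ e c d * T c := fun e => by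
      rw [← hX (fun c => Γ e c d) b e]
      exact Finset.sum_congr rfl fun c _ => mul_comm _ _
    simp only [h, Finset.sum_sub_distrib, Finset.sum_add_distrib, Finset.sum_mul,
      Finset.mul_sum]
    congr 1
    · exact add_comm _ _
    · rw [Finset.sum_comm]
      exact Finset.sum_congr rfl fun c _ => Finset.sum_congr rfl fun e _ => by
        rw [hΓ e c d]; ring
  have h8 : ∑ c, ∑ e, C c b e * C e c d
      = (N + 2) * (φ b * φ d) - 2 * (g b d * ∑ e, φ e * T e) := by
    simp only [hX, Finset.sum_sub_distrib, Finset.sum_add_distrib]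
    have e1 : ∑ c, C c b c * φ d = N * φ b * φ d := by
      rw [← Finset.sum_mul, ← hsum b]
      congr 1
      exact Finset.sum_congr rfl fun c _ => conformalDiff_symm hg φ T c b c
    have e2 : ∑ c, C c b d * φ c = 2 * (φ b * φ d) - g b d * ∑ e, φ e * T e := by
      rw [← sub_eq_zero, ← sub_eq_zero.2 (hX φ b d)]
      simp only [mul_comm (φ _) (C _ _ _)]
      ring
    have e3 : ∑ c, g c d * ∑ e, C c b e * T e = g b d * ∑ e, φ e * T e := by
      simp only [Finset.mul_sum]
      rw [Finset.sum_comm]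
      have h : ∀ e, ∑ c, g c d * (C c b e * T e)
          = (g b d * φ e + g e d * φ b - g b e * φ d) * T e := fun e => by
        simp only [← mul_assoc, ← Finset.sum_mul]
        rw [hX (fun c => g c d) b e, ← hT d]
        simp only [hg _ d]
      have h' : ∀ e, (g b d * φ e + g e d * φ b - g b e * φ d) * T e
          = g b d * (φ e * T e) + φ b * (g d e * T e) - φ d * (g b e * T e) := fun e => by
        rw [hg e d]; ring
      simp only [h, h', Finset.sum_sub_distrib, Finset.sum_add_distrib, ← Finset.mul_sum, hT]
      ring
    rw [e1, e2, e3]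
    ring
  simp only [add_mul, mul_add, Finset.sum_sub_distrib, Finset.sum_add_distrib]
  rw [h3, h4, h5, h6, h7, h8]
  ring

end ConformalAlgebra

/-! ### Levi-Civita connection and its conformal change. -/

section ChristoffelSymbols

variable {n : ℕ} {K : Set (Model n)} {G G' : Model n → Matrix (Fin (n + 1)) (Fin (n + 1)) ℝ}
  {φ : Model n → ℝ} {y : Model n}

/-- `G` is the matrix of a smooth (pseudo-Riemannian) metric on `K`. -/
structure IsMetricOn (K : Set (Model n)) (G : Model n → Matrix (Fin (n + 1)) (Fin (n + 1)) ℝ) :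
    Prop where
  relOpen : IsRelOpen K
  smooth : ∀ i j, ContDiffOn ℝ ∞ (fun z => G z i j) K
  symm : ∀ z ∈ K, ∀ i j, G z i j = G z j i
  det : ∀ z ∈ K, IsUnit (G z).det

namespace IsMetricOn

theorem mem_range (hG : IsMetricOn K G) (hy : y ∈ K) : y ∈ range (𝓡∂ (n + 1)) := hG.relOpen.1 hy

theorem differentiable (hG : IsMetricOn K G) (hy : y ∈ K) (i j : Fin (n + 1)) :
    DifferentiableWithinAt ℝ (fun z => G z i j) (range (𝓡∂ (n + 1))) y :=
  hG.relOpen.differentiableWithinAt (hG.smooth i j) hy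

theorem sum_mul_inv (hG : IsMetricOn K G) (hy : y ∈ K) (i j : Fin (n + 1)) :
    ∑ k, G y i k * (G y)⁻¹ k j = if i = j then 1 else 0 := by
  rw [← Matrix.mul_apply, Matrix.mul_nonsing_inv _ (hG.det y hy), Matrix.one_apply]

theorem sum_inv_mul (hG : IsMetricOn K G) (hy : y ∈ K) (i j : Fin (n + 1)) :
    ∑ k, (G y)⁻¹ i k * G y k j = if i = j then 1 else 0 := by
  rw [← Matrix.mul_apply, Matrix.nonsing_inv_mul _ (hG.det y hy), Matrix.one_apply]

theorem inv_symm (hG : IsMetricOn K G) (hy : y ∈ K) (i j : Fin (n + 1)) :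
    (G y)⁻¹ i j = (G y)⁻¹ j i := by
  have h : (G y).transpose = G y := by
    ext a b
    exact hG.symm y hy b a
  conv_lhs => rw [← h, ← Matrix.transpose_nonsing_inv]
  rfl

theorem smooth_inv (hG : IsMetricOn K G) (i j : Fin (n + 1)) :
    ContDiffOn ℝ ∞ (fun z => (G z)⁻¹ i j) K :=
  contDiffOn_inv_apply hG.smooth hG.det i j

theorem smooth_christoffel (hG : IsMetricOn K G) (k i j : Fin (n + 1)) :
    ContDiffOn ℝ ∞ (fun z => christoffel G z k i j) K := by
  have h := fun i j l => hG.relOpen.contDiffOn_pd (hG.smooth i j) l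
  exact contDiffOn_const.mul (ContDiffOn.sum fun l _ =>
    (hG.smooth_inv k l).mul (((h j l i).add (h i l j)).sub (h i j l)))

theorem pd_symm (hG : IsMetricOn K G) (hy : y ∈ K) (l i j : Fin (n + 1)) :
    pd l (fun z => G z i j) y = pd l (fun z => G z j i) y :=
  hG.relOpen.pd_congr (fun z hz => hG.symm z hz i j) hy l

theorem christoffel_symm (hG : IsMetricOn K G) (hy : y ∈ K) (k i j : Fin (n + 1)) :
    christoffel G y k i j = christoffel G y k j i := by
  unfold christoffel
  congr 1
  exact Finset.sum_congr rfl fun l _ => by rw [hG.pd_symm hy l i j]; ring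

theorem sum_mul_christoffel (hG : IsMetricOn K G) (hy : y ∈ K) (m i j : Fin (n + 1)) :
    ∑ k, G y m k * christoffel G y k i j
      = (1 / 2) * (pd i (fun z => G z j m) y + pd j (fun z => G z i m) y
        - pd m (fun z => G z i j) y) := by
  unfold christoffel
  have h : ∀ k, G y m k * ((1 / 2) * ∑ l, (G y)⁻¹ k l *
      (pd i (fun z => G z j l) y + pd j (fun z => G z i l) y - pd l (fun z => G z i j) y))
      = (1 / 2) * ∑ l, (G y m k * (G y)⁻¹ k l) *
      (pd i (fun z => G z j l) y + pd j (fun z => G z i l) y - pd l (fun z => G z i j) y) := by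
    intro k
    simp only [Finset.mul_sum]
    exact Finset.sum_congr rfl fun l _ => by ring
  simp only [h, ← Finset.mul_sum]
  rw [Finset.sum_comm]
  simp only [← Finset.sum_mul, hG.sum_mul_inv hy, ite_mul, one_mul, zero_mul, Finset.sum_ite_eq,
    Finset.mem_univ, if_true]

/-- The Levi-Civita connection is metric. -/
theorem pd_eq (hG : IsMetricOn K G) (hy : y ∈ K) (a b d : Fin (n + 1)) :
    pd a (fun z => G z b d) y
      = ∑ e, G y d e * christoffel G y e a b + ∑ e, G y b e * christoffel G y e a d := by
  rw [hG.sum_mul_christoffel hy, hG.sum_mul_christoffel hy, hG.pd_symm hy a d b,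
    hG.pd_symm hy b a d, hG.pd_symm hy d a b]
  rw [hG.pd_symm hy b d a, hG.pd_symm hy d b a]
  ring

end IsMetricOn

/-- The vector `h^ij α_j`. -/
def raise (G : Matrix (Fin (n + 1)) (Fin (n + 1)) ℝ) (α : Fin (n + 1) → ℝ) (k : Fin (n + 1)) : ℝ :=
  ∑ l, G⁻¹ k l * α l

theorem IsMetricOn.sum_mul_raise (hG : IsMetricOn K G) (hy : y ∈ K) (α : Fin (n + 1) → ℝ)
    (i : Fin (n + 1)) : ∑ k, G y i k * raise (G y) α k = α i := by
  simp only [raise, Finset.mul_sum, ← mul_assoc]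
  rw [Finset.sum_comm]
  simp [← Finset.sum_mul, hG.sum_mul_inv hy]

theorem IsMetricOn.smooth_raise (hG : IsMetricOn K G) {α : Model n → Fin (n + 1) → ℝ}
    (hα : ∀ i, ContDiffOn ℝ ∞ (fun z => α z i) K) (k : Fin (n + 1)) :
    ContDiffOn ℝ ∞ (fun z => raise (G z) (α z) k) K :=
  ContDiffOn.sum fun l _ => (hG.smooth_inv k l).mul (hα l)

/-- `∇^i α_i` for a covector field `α`. -/
def divergence (G : Model n → Matrix (Fin (n + 1)) (Fin (n + 1)) ℝ)
    (α : Model n → Fin (n + 1) → ℝ) (y : Model n) : ℝ :=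
  ∑ i, ∑ j, (G y)⁻¹ i j * covCovector G α y i j

/-- Metric compatibility: lowering the index commutes with ∇, so ∇_a α_b = g_bk (∂_a α^k + Γ^k_ae
α^e). -/
theorem covCovector_eq (hG : IsMetricOn K G) {α : Model n → Fin (n + 1) → ℝ}
    (hα : ∀ i, ContDiffOn ℝ ∞ (fun z => α z i) K) (hy : y ∈ K) (a b : Fin (n + 1)) :
    covCovector G α y a b
      = ∑ k, (∑ e, G y b e * christoffel G y e a k) * raise (G y) (α y) k
        + ∑ k, G y b k * pd a (fun z => raise (G z) (α z) k) y := by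
  set T : Fin (n + 1) → ℝ := raise (G y) (α y) with hT
  have hr := hG.mem_range hy
  have hdT : ∀ c, DifferentiableWithinAt ℝ (fun z => raise (G z) (α z) c)
      (range (𝓡∂ (n + 1))) y := fun c => hG.relOpen.differentiableWithinAt (hG.smooth_raise hα c) hy
  have h1 : pd a (fun z => α z b) y
      = ∑ k, (pd a (fun z => G z b k) y * T k
        + G y b k * pd a (fun z => raise (G z) (α z) k) y) := by
    rw [hG.relOpen.pd_congr (fun z hz => (hG.sum_mul_raise hz (α z) b).symm) hy,
      pd_sum (f := fun k z => G z b k * raise (G z) (α z) k) _ hr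
        fun k _ => (hG.differentiable hy b k).mul (hdT k)]
    exact Finset.sum_congr rfl fun k _ => pd_mul hr (hG.differentiable hy b k) (hdT k) a
  have h3 : ∑ k, (∑ e, G y k e * christoffel G y e a b) * T k
      = ∑ e, christoffel G y e a b * α y e := by
    simp only [Finset.sum_mul]
    rw [Finset.sum_comm]
    refine Finset.sum_congr rfl fun e _ => ?_
    rw [← hG.sum_mul_raise hy (α y) e, Finset.mul_sum]
    exact Finset.sum_congr rfl fun k _ => by rw [hG.symm y hy k e]; ring
  unfold covCovector
  rw [h1, ← h3]
  simp only [hG.pd_eq hy a b, add_mul, Finset.sum_add_distrib]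
  ring

/-- The trace of `covCovector_eq`. The left side is the form in which the divergence of the gradient
of φ appears in the Ricci curvature. -/
theorem sum_pd_raise (hG : IsMetricOn K G) {α : Model n → Fin (n + 1) → ℝ}
    (hα : ∀ i, ContDiffOn ℝ ∞ (fun z => α z i) K) (hy : y ∈ K) :
    ∑ c, pd c (fun z => raise (G z) (α z) c) y + ∑ c, ∑ e, christoffel G y c c e * raise (G y) (α y) e
      = divergence G α y := by
  have h4 : ∀ X : Fin (n + 1) → Fin (n + 1) → ℝ,
      ∑ a, ∑ b, (G y)⁻¹ a b * ∑ k, G y b k * X a k = ∑ a, X a a := by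
    intro X
    refine Finset.sum_congr rfl fun a _ => ?_
    simp only [Finset.mul_sum, ← mul_assoc]
    rw [Finset.sum_comm]
    simp [← Finset.sum_mul, hG.sum_inv_mul hy]
  unfold divergence
  simp only [covCovector_eq hG hα hy, mul_add, Finset.sum_add_distrib]
  rw [h4, add_comm]
  congr 1
  rw [← h4 fun a k => ∑ e, christoffel G y k a e * raise (G y) (α y) e]
  refine Finset.sum_congr rfl fun a _ => Finset.sum_congr rfl fun b _ => ?_
  congr 1
  simp only [Finset.mul_sum, Finset.sum_mul]
  rw [Finset.sum_comm]
  exact Finset.sum_congr rfl fun k _ => Finset.sum_congr rfl fun e _ => by ring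

/-- The metric `G'` is `e^(2φ) G` on `K`. -/
structure IsConformalOn (K : Set (Model n))
    (G G' : Model n → Matrix (Fin (n + 1)) (Fin (n + 1)) ℝ) (φ : Model n → ℝ) : Prop where
  metric : IsMetricOn K G
  smooth : ContDiffOn ℝ ∞ φ K
  eq : ∀ z ∈ K, G' z = Real.exp (2 * φ z) • G z

namespace IsConformalOn

theorem inv_eq (h : IsConformalOn K G G' φ) (hy : y ∈ K) :
    (G' y)⁻¹ = Real.exp (-(2 * φ y)) • (G y)⁻¹ := by
  refine Matrix.inv_eq_left_inv ?_
  rw [h.eq y hy, Matrix.smul_mul, Matrix.mul_smul, smul_smul, ← Real.exp_add,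
    Matrix.nonsing_inv_mul _ (h.metric.det y hy)]
  simp

theorem differentiable (h : IsConformalOn K G G' φ) (hy : y ∈ K) :
    DifferentiableWithinAt ℝ φ (range (𝓡∂ (n + 1))) y :=
  h.metric.relOpen.differentiableWithinAt h.smooth hy

theorem smooth_pd (h : IsConformalOn K G G' φ) (i : Fin (n + 1)) :
    ContDiffOn ℝ ∞ (fun z => pd i φ z) K :=
  h.metric.relOpen.contDiffOn_pd h.smooth i

theorem pd_eq (h : IsConformalOn K G G' φ) (hy : y ∈ K) (i j l : Fin (n + 1)) :
    pd i (fun z => G' z j l) y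
      = Real.exp (2 * φ y) * (pd i (fun z => G z j l) y + 2 * pd i φ y * G y j l) := by
  have hr := h.metric.mem_range hy
  have hd := h.differentiable hy
  have e : EqOn (fun z => G' z j l) (fun z => Real.exp (2 * φ z) * G z j l) K := fun z hz => by
    simp [h.eq z hz]
  rw [h.metric.relOpen.pd_congr e hy, pd_mul hr (hd.const_mul 2).exp (h.metric.differentiable hy j l),
    pd_exp hr (hd.const_mul 2), pd_const_mul hr 2 hd]
  ring

/-- Differentiating e^(2φ) adds 2 Υ_i g_jl to ∂_i g_jl; the factor e^(2φ) itself cancels against the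
inverse metric. -/
theorem christoffel_eq (h : IsConformalOn K G G' φ) (hy : y ∈ K) (k i j : Fin (n + 1)) :
    christoffel G' y k i j = christoffel G y k i j
      + conformalDiff (G y) (fun a => pd a φ y) (raise (G y) fun a => pd a φ y) k i j := by
  have hG := h.metric
  have e : ∀ l, (G' y)⁻¹ k l * (pd i (fun z => G' z j l) y + pd j (fun z => G' z i l) y
        - pd l (fun z => G' z i j) y)
      = (G y)⁻¹ k l * (pd i (fun z => G z j l) y + pd j (fun z => G z i l) y
        - pd l (fun z => G z i j) y)
        + 2 * (pd i φ y * ((G y)⁻¹ k l * G y l j) + pd j φ y * ((G y)⁻¹ k l * G y l i)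
          - G y i j * ((G y)⁻¹ k l * pd l φ y)) := by
    intro l
    rw [h.inv_eq hy, h.pd_eq hy, h.pd_eq hy, h.pd_eq hy, Matrix.smul_apply, smul_eq_mul,
      Real.exp_neg, hG.symm y hy j l, hG.symm y hy i l]
    have := (Real.exp_pos (2 * φ y)).ne'
    field_simp
    ring
  unfold christoffel
  simp only [e, Finset.sum_add_distrib, ← Finset.mul_sum, Finset.sum_sub_distrib,
    hG.sum_inv_mul hy, mul_add]
  congr 1
  simp only [conformalDiff, raise, mul_ite, mul_one, mul_zero]
  ring

end IsConformalOn

end ChristoffelSymbols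

/-! ### Conformal change of divergences and of the Ricci tensor. -/

section RicciCurvature

variable {n : ℕ} {K : Set (Model n)} {G G' : Model n → Matrix (Fin (n + 1)) (Fin (n + 1)) ℝ}
  {φ : Model n → ℝ} {y : Model n}

/-- The pairing `h^ij α_i β_j` of covectors. -/
def pairing (G : Matrix (Fin (n + 1)) (Fin (n + 1)) ℝ) (α β : Fin (n + 1) → ℝ) : ℝ :=
  ∑ k, α k * raise G β k

/-- The differential of `f`, in components. -/
def differential (f : Model n → ℝ) (z : Model n) (i : Fin (n + 1)) : ℝ := pd i f z

theorem sum_inv_mul_mul (G : Matrix (Fin (n + 1)) (Fin (n + 1)) ℝ) (α β : Fin (n + 1) → ℝ) :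
    ∑ a, ∑ b, G⁻¹ a b * α a * β b = pairing G α β := by
  simp only [pairing, raise, Finset.mul_sum]
  exact Finset.sum_congr rfl fun a _ => Finset.sum_congr rfl fun b _ => by ring

theorem pairing_add_left (G : Matrix (Fin (n + 1)) (Fin (n + 1)) ℝ) (α β γ : Fin (n + 1) → ℝ) :
    pairing G (fun i => α i + β i) γ = pairing G α γ + pairing G β γ := by
  simp only [pairing, add_mul, Finset.sum_add_distrib]

theorem pairing_mul_left (G : Matrix (Fin (n + 1)) (Fin (n + 1)) ℝ) (c : ℝ)
    (α γ : Fin (n + 1) → ℝ) :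
    pairing G (fun i => c * α i) γ = c * pairing G α γ := by
  simp only [pairing, mul_assoc, Finset.mul_sum]

theorem IsMetricOn.pairing_comm (hG : IsMetricOn K G) (hy : y ∈ K) (α β : Fin (n + 1) → ℝ) :
    pairing (G y) α β = pairing (G y) β α := by
  simp only [pairing, raise, Finset.mul_sum]
  rw [Finset.sum_comm]
  exact Finset.sum_congr rfl fun a _ => Finset.sum_congr rfl fun b _ => by
    rw [hG.inv_symm hy]; ring

theorem IsMetricOn.pairing_add_right (hG : IsMetricOn K G) (hy : y ∈ K)
    (α β γ : Fin (n + 1) → ℝ) :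
    pairing (G y) γ (fun i => α i + β i) = pairing (G y) γ α + pairing (G y) γ β := by
  rw [hG.pairing_comm hy, pairing_add_left, hG.pairing_comm hy α, hG.pairing_comm hy β]

theorem IsMetricOn.pairing_mul_right (hG : IsMetricOn K G) (hy : y ∈ K) (c : ℝ)
    (α γ : Fin (n + 1) → ℝ) :
    pairing (G y) γ (fun i => c * α i) = c * pairing (G y) γ α := by
  rw [hG.pairing_comm hy, pairing_mul_left, hG.pairing_comm hy]

theorem IsMetricOn.trace (hG : IsMetricOn K G) (hy : y ∈ K) :
    ∑ i, ∑ j, (G y)⁻¹ i j * G y i j = (n : ℝ) + 1 := by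
  have h : ∀ i, ∑ j, (G y)⁻¹ i j * G y i j = 1 := fun i => by
    rw [← (if_pos rfl : (if i = i then (1 : ℝ) else 0) = 1), ← hG.sum_inv_mul hy i i]
    exact Finset.sum_congr rfl fun j _ => by rw [hG.symm y hy]
  simp [h]

theorem divergence_congr (hK : IsRelOpen K) {α β : Model n → Fin (n + 1) → ℝ}
    (h : EqOn α β K) (hy : y ∈ K) : divergence G α y = divergence G β y := by
  unfold divergence covCovector
  rw [h hy]
  simp only [fun i j => hK.pd_congr (fun z hz => congrFun (h hz) j) hy i]

theorem IsMetricOn.divergence_add (hG : IsMetricOn K G) {α β : Model n → Fin (n + 1) → ℝ}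
    (hα : ∀ i, ContDiffOn ℝ ∞ (fun z => α z i) K) (hβ : ∀ i, ContDiffOn ℝ ∞ (fun z => β z i) K)
    (hy : y ∈ K) :
    divergence G (fun z i => α z i + β z i) y = divergence G α y + divergence G β y := by
  have hα' := fun i => hG.relOpen.differentiableWithinAt (hα i) hy
  have hβ' := fun i => hG.relOpen.differentiableWithinAt (hβ i) hy
  unfold divergence covCovector
  simp only [pd_add (hG.mem_range hy) (hα' _) (hβ' _), ← Finset.sum_add_distrib, ← mul_add]
  congr! 3
  simp only [mul_add, Finset.sum_add_distrib]
  ring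

theorem IsMetricOn.divergence_mul (hG : IsMetricOn K G) {f : Model n → ℝ}
    {α : Model n → Fin (n + 1) → ℝ} (hf : ContDiffOn ℝ ∞ f K)
    (hα : ∀ i, ContDiffOn ℝ ∞ (fun z => α z i) K) (hy : y ∈ K) :
    divergence G (fun z i => f z * α z i) y
      = f y * divergence G α y + pairing (G y) (differential f y) (α y) := by
  have hα' := fun i => hG.relOpen.differentiableWithinAt (hα i) hy
  have hf' := hG.relOpen.differentiableWithinAt hf hy
  rw [← sum_inv_mul_mul]
  unfold divergence covCovector differential
  simp only [pd_mul (hG.mem_range hy) hf' (hα' _), Finset.mul_sum, ← Finset.sum_add_distrib]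
  refine Finset.sum_congr rfl fun i _ => Finset.sum_congr rfl fun j _ => ?_
  have : ∑ k, christoffel G y k i j * (f y * α y k) = f y * ∑ k, christoffel G y k i j * α y k := by
    rw [Finset.mul_sum]
    exact Finset.sum_congr rfl fun k _ => by ring
  rw [this]
  ring

theorem laplacian_eq_neg_divergence (G : Model n → Matrix (Fin (n + 1)) (Fin (n + 1)) ℝ)
    (f : Model n → ℝ) (y : Model n) :
    laplacian G (fun _ _ _ => 0) f y = -divergence G (differential f) y := by
  have h : ∀ j, covD (fun _ _ _ => (0 : ℝ)) j f = fun z => pd j f z := fun j => by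
    funext z
    simp [covD]
  simp [laplacian, hess, h, divergence, covCovector, differential, mul_sub, covD]

namespace IsConformalOn

theorem smooth_differential (h : IsConformalOn K G G' φ) (i : Fin (n + 1)) :
    ContDiffOn ℝ ∞ (fun z => differential φ z i) K := h.smooth_pd i

theorem sum_inv_eq (h : IsConformalOn K G G' φ) (hy : y ∈ K)
    (X : Fin (n + 1) → Fin (n + 1) → ℝ) :
    ∑ i, ∑ j, (G' y)⁻¹ i j * X i j
      = Real.exp (-(2 * φ y)) * ∑ i, ∑ j, (G y)⁻¹ i j * X i j := by
  simp only [h.inv_eq hy, Matrix.smul_apply, smul_eq_mul, Finset.mul_sum, mul_assoc]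

/-- The trace g^ij C^k_ij of the difference tensor is (2 - d) Υ^k, and 2 - d = 1 - n; it enters a
covariant derivative of covectors with a minus sign. -/
theorem divergence_eq (h : IsConformalOn K G G' φ) (α : Model n → Fin (n + 1) → ℝ) (hy : y ∈ K) :
    divergence G' α y = Real.exp (-(2 * φ y)) *
      (divergence G α y + ((n : ℝ) - 1) * pairing (G y) (α y) (differential φ y)) := by
  have hG := h.metric
  have e : ∀ i j, covCovector G' α y i j = covCovector G α y i j
      - (α y i * differential φ y j + α y j * differential φ y i)
      + G y i j * pairing (G y) (α y) (differential φ y) := by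
    intro i j
    unfold covCovector
    simp only [h.christoffel_eq hy, add_mul, Finset.sum_add_distrib]
    have := sum_mul_conformalDiff (G y) (differential φ y) (raise (G y) (differential φ y))
      (α y) i j
    simp only [mul_comm (α y _) (conformalDiff _ _ _ _ _ _)] at this
    unfold differential at this ⊢
    rw [this]
    simp only [pairing]
    ring
  have e1 : ∑ i, ∑ j, (G y)⁻¹ i j * (α y i * differential φ y j + α y j * differential φ y i)
      = 2 * pairing (G y) (α y) (differential φ y) := by
    rw [two_mul]
    nth_rw 2 [hG.pairing_comm hy]
    rw [← sum_inv_mul_mul, ← sum_inv_mul_mul]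
    simp only [← Finset.sum_add_distrib]
    exact Finset.sum_congr rfl fun i _ => Finset.sum_congr rfl fun j _ => by ring
  unfold divergence
  rw [h.sum_inv_eq hy]
  simp only [e, mul_add, mul_sub, Finset.sum_add_distrib, Finset.sum_sub_distrib] at e1 ⊢
  simp only [← mul_assoc, ← Finset.sum_mul, hG.trace hy] at e1 ⊢
  linear_combination (-Real.exp (-(2 * φ y))) * e1

/-- The conformal change of the Ricci curvature. -/
theorem ricci_eq (h : IsConformalOn K G G' φ) (hy : y ∈ K) (b d : Fin (n + 1)) :
    ricci G' y b d = ricci G y b d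
      + (pd d (fun z => differential φ z b) y - n * pd b (fun z => differential φ z d) y)
      + ((n : ℝ) - 1) * ∑ e, christoffel G y e b d * differential φ y e
      + ((n : ℝ) - 1) * (differential φ y b * differential φ y d)
      - G y b d * (divergence G (differential φ) y
        + ((n : ℝ) - 1) * pairing (G y) (differential φ y) (differential φ y)) := by
  have hG := h.metric
  have hr := hG.mem_range hy
  set D := differential φ with hD
  have hDs : ∀ i, ContDiffOn ℝ ∞ (fun z => D z i) K := h.smooth_differential
  have hDd : ∀ i, DifferentiableWithinAt ℝ (fun z => D z i) (range (𝓡∂ (n + 1))) y :=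
    fun i => hG.relOpen.differentiableWithinAt (hDs i) hy
  have hTd : ∀ c, DifferentiableWithinAt ℝ (fun z => raise (G z) (D z) c)
      (range (𝓡∂ (n + 1))) y :=
    fun c => hG.relOpen.differentiableWithinAt (hG.smooth_raise hDs c) hy
  have hΓd : ∀ k i j, DifferentiableWithinAt ℝ (fun z => christoffel G z k i j)
      (range (𝓡∂ (n + 1))) y :=
    fun k i j => hG.relOpen.differentiableWithinAt (hG.smooth_christoffel k i j) hy
  have hΓ' : ∀ k i j, ∀ z ∈ K, christoffel G' z k i j
      = christoffel G z k i j + conformalDiff (G z) (D z) (raise (G z) (D z)) k i j :=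
    fun k i j z hz => h.christoffel_eq hz k i j
  have hif : ∀ (p : Prop) [Decidable p] (i : Fin (n + 1)),
      DifferentiableWithinAt ℝ (fun z => if p then D z i else 0) (range (𝓡∂ (n + 1))) y := by
    intro p _ i
    by_cases hp : p
    · simpa [hp] using hDd i
    · simpa [hp] using differentiableWithinAt_const (0 : ℝ)
  have hpdif : ∀ (p : Prop) [Decidable p] (i c : Fin (n + 1)),
      pd c (fun z => if p then D z i else 0) y = if p then pd c (fun z => D z i) y else 0 := by
    intro p _ i c
    by_cases hp : p
    · simp [hp]
    · simp [hp, pd_const]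
  have hCd : ∀ k i j, DifferentiableWithinAt ℝ
      (fun z => conformalDiff (G z) (D z) (raise (G z) (D z)) k i j) (range (𝓡∂ (n + 1))) y :=
    fun k i j => ((hif _ j).add (hif _ i)).sub ((hG.differentiable hy i j).mul (hTd k))
  have hC1 : ∀ c, pd c (fun z => conformalDiff (G z) (D z) (raise (G z) (D z)) c b d) y
      = (if c = b then pd c (fun z => D z d) y else 0)
        + (if c = d then pd c (fun z => D z b) y else 0)
        - (pd c (fun z => G z b d) y * raise (G y) (D y) c
          + G y b d * pd c (fun z => raise (G z) (D z) c) y) := by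
    intro c
    unfold conformalDiff
    rw [pd_sub (f := fun z => (if c = b then D z d else 0) + (if c = d then D z b else 0))
        (g := fun z => G z b d * raise (G z) (D z) c) hr
        ((hif _ d).add (hif _ b)) ((hG.differentiable hy b d).mul (hTd c)),
      pd_add hr (hif _ d) (hif _ b), pd_mul hr (hG.differentiable hy b d) (hTd c), hpdif, hpdif]
  -- The contraction C^c_cd = d Υ_d is taken before differentiating. Mixed partials ∂_b Υ_d and ∂_d
  -- Υ_b are kept apart; they are identified only after tracing, in `schoutenTrace_eq`.
  have hC2 : ∑ c, pd b (fun z => conformalDiff (G z) (D z) (raise (G z) (D z)) c c d) y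
      = ((n : ℝ) + 1) * pd b (fun z => D z d) y := by
    rw [← pd_sum _ hr fun c _ => hCd c c d, ← pd_const_mul hr _ (hDd d)]
    refine hG.relOpen.pd_congr (fun z hz => ?_) hy b
    simpa using sum_conformalDiff (hG.sum_mul_raise hz (D z)) (hG.symm z hz) d
  have hpd : ∀ c i j, pd c (fun z => christoffel G' z c i j) y = pd c (fun z => christoffel G z c i j) y
      + pd c (fun z => conformalDiff (G z) (D z) (raise (G z) (D z)) c i j) y := by
    intro c i j
    rw [hG.relOpen.pd_congr (hΓ' c i j) hy, pd_add hr (hΓd _ _ _) (hCd _ _ _)]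
  have hpd' : ∀ c, pd b (fun z => christoffel G' z c c d) y = pd b (fun z => christoffel G z c c d) y
      + pd b (fun z => conformalDiff (G z) (D z) (raise (G z) (D z)) c c d) y := by
    intro c
    rw [hG.relOpen.pd_congr (hΓ' c c d) hy, pd_add hr (hΓd _ _ _) (hCd _ _ _)]
  have hquad := sum_christoffel_add_conformalDiff (hG.symm y hy) (hG.christoffel_symm hy)
    (hG.sum_mul_raise hy (D y)) b d
  have hdiv := sum_pd_raise hG hDs hy
  -- The derivatives of g_bd in ∂_c C^c_bd turn into Christoffel symbols, which cancel the two mixed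
  -- terms of `hquad` with a lowered index.
  have hmet : ∑ c, pd c (fun z => G z b d) y * raise (G y) (D y) c
      = ∑ c, (∑ e, G y d e * christoffel G y e b c) * raise (G y) (D y) c
        + ∑ c, (∑ e, G y b e * christoffel G y e d c) * raise (G y) (D y) c := by
    simp only [hG.pd_eq hy _ b d, add_mul, Finset.sum_add_distrib]
    simp only [hG.christoffel_symm hy _ _ b, hG.christoffel_symm hy _ _ d]
  simp only [ricci, riemann, Finset.sum_add_distrib, Finset.sum_sub_distrib] at hquad ⊢
  simp only [← Finset.sum_sub_distrib] at hquad ⊢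
  simp only [hΓ' _ _ _ y hy, hpd, hpd']
  simp only [hC1, Finset.sum_add_distrib, Finset.sum_sub_distrib, Finset.sum_ite_eq',
    Finset.mem_univ, if_true, ← Finset.mul_sum, hC2, hmet] at hquad ⊢
  simp only [Fintype.card_fin, Nat.cast_add, Nat.cast_one] at hquad
  unfold pairing
  linear_combination hquad - G y b d * hdiv

end IsConformalOn

end RicciCurvature

/-! ### Thomas operator: conformal covariance, and its form in an Einstein scale. -/

section ThomasOperator

variable {n : ℕ} {K : Set (Model n)} {G G' : Model n → Matrix (Fin (n + 1)) (Fin (n + 1)) ℝ}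
  {φ : Model n → ℝ} {y : Model n}

theorem thomasD_density (G : Model n → Matrix (Fin (n + 1)) (Fin (n + 1)) ℝ) (w : ℝ)
    (f : Model n → ℝ) (y : Model n) :
    thomasD G (fun _ _ _ => 0) w f y
      = slots (((n : ℝ) - 1 + 2 * w) * w * f y)
        (fun a => ((n : ℝ) - 1 + 2 * w) * differential f y a)
        (-divergence G (differential f) y - w * schoutenTrace G y * f y) := by
  unfold thomasD
  rw [laplacian_eq_neg_divergence]
  simp only [covD, smul_eq_mul, differential, add_zero]
  congr! 2
  · ring
  · ring

theorem scaleTractor_eq (G : Model n → Matrix (Fin (n + 1)) (Fin (n + 1)) ℝ)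
    (s : Model n → ℝ) (y : Model n) :
    scaleTractor G s y = slots (s y) (differential s y)
      (-(1 / ((n : ℝ) + 1)) * (divergence G (differential s) y + schoutenTrace G y * s y)) := by
  have h : (n : ℝ) + 1 ≠ 0 := by positivity
  unfold scaleTractor
  rw [thomasD_density]
  funext α
  rcases α with _ | a | _ <;> simp only [slots, Sum.elim_inl, Sum.elim_inr, Pi.smul_apply,
    smul_eq_mul] <;> field_simp <;> ring

theorem tractorPair_eq (G : Matrix (Fin (n + 1)) (Fin (n + 1)) ℝ) (U V : TIdx n → ℝ) :
    tractorPair G U V = topSlot U * botSlot V + botSlot U * topSlot V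
      + pairing G (midSlot U) (midSlot V) := by
  rw [← sum_inv_mul_mul]
  rfl

theorem tractorChange_eq (G : Matrix (Fin (n + 1)) (Fin (n + 1)) ℝ) (Ω : ℝ)
    (Υ : Fin (n + 1) → ℝ) (U : TIdx n → ℝ) :
    tractorChange G Ω Υ U = slots (Ω * topSlot U)
      (fun a => Ω * (midSlot U a + topSlot U * Υ a))
      (Ω⁻¹ * (botSlot U - pairing G Υ (midSlot U) - (1 / 2) * pairing G Υ Υ * topSlot U)) := by
  simp only [tractorChange, sum_inv_mul_mul]
  congr! 3
  ring

theorem pairing_smul (G : Matrix (Fin (n + 1)) (Fin (n + 1)) ℝ) {c : ℝ} {G' : Matrix _ _ ℝ}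
    (h : G'⁻¹ = c • G⁻¹) (α β : Fin (n + 1) → ℝ) : pairing G' α β = c * pairing G α β := by
  simp only [← sum_inv_mul_mul, h, Matrix.smul_apply, smul_eq_mul, Finset.mul_sum, mul_assoc]

namespace IsConformalOn

theorem isMetricOn (h : IsConformalOn K G G' φ) : IsMetricOn K G' where
  relOpen := h.metric.relOpen
  smooth i j := by
    refine ((h.smooth.const_smul (2 : ℝ)).exp.mul (h.metric.smooth i j)).congr fun z hz => ?_
    simp [h.eq z hz]
  symm z hz i j := by simp [h.eq z hz, h.metric.symm z hz i j]
  det z hz := by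
    rw [h.eq z hz, Matrix.det_smul]
    exact ((Real.exp_ne_zero _).isUnit.pow _).mul (h.metric.det z hz)

/-- The conformal invariance of the tractor metric. -/
theorem tractorPair_tractorChange (h : IsConformalOn K G G' φ) (hy : y ∈ K)
    (Υ : Fin (n + 1) → ℝ) (U V : TIdx n → ℝ) :
    tractorPair (G' y) (tractorChange (G y) (Real.exp (φ y)) Υ U)
        (tractorChange (G y) (Real.exp (φ y)) Υ V)
      = tractorPair (G y) U V := by
  have hG := h.metric
  simp only [tractorPair_eq, tractorChange_eq, pairing_smul (G y) (h.inv_eq hy)]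
  have e : ∀ W : TIdx n → ℝ, midSlot (slots (Real.exp (φ y) * topSlot W)
      (fun a => Real.exp (φ y) * (midSlot W a + topSlot W * Υ a))
      ((Real.exp (φ y))⁻¹ * (botSlot W - pairing (G y) Υ (midSlot W)
        - (1 / 2) * pairing (G y) Υ Υ * topSlot W)))
      = fun a => Real.exp (φ y) * (midSlot W a + topSlot W * Υ a) := fun _ => rfl
  rw [e, e, pairing_mul_left, hG.pairing_mul_right hy, pairing_add_left,
    hG.pairing_add_right hy, hG.pairing_add_right hy, pairing_mul_left, pairing_mul_left,
    hG.pairing_mul_right hy, hG.pairing_mul_right hy, hG.pairing_comm hy (midSlot U) Υ]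
  simp only [topSlot, botSlot, slots, Sum.elim_inl, Sum.elim_inr]
  have h2 : Real.exp (-(2 * φ y)) = (Real.exp (φ y))⁻¹ * (Real.exp (φ y))⁻¹ := by
    rw [← Real.exp_neg, ← Real.exp_add]
    ring_nf
  rw [h2]
  have := Real.exp_ne_zero (φ y)
  field_simp
  ring

/-- The conformal change of the trace of the Schouten tensor. -/
theorem schoutenTrace_eq (hn : n ≠ 0) (h : IsConformalOn K G G' φ) (hy : y ∈ K) :
    schoutenTrace G' y = Real.exp (-(2 * φ y)) * (schoutenTrace G y
      - divergence G (differential φ) y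
      - ((n : ℝ) - 1) / 2 * pairing (G y) (differential φ y) (differential φ y)) := by
  have hG := h.metric
  have hn' : (n : ℝ) ≠ 0 := Nat.cast_ne_zero.2 hn
  have e1 : ∑ b, ∑ d, (G y)⁻¹ b d * pd d (fun z => differential φ z b) y
      = ∑ b, ∑ d, (G y)⁻¹ b d * pd b (fun z => differential φ z d) y := by
    rw [Finset.sum_comm]
    exact Finset.sum_congr rfl fun b _ => Finset.sum_congr rfl fun d _ => by
      rw [hG.inv_symm hy]
  have e2 : divergence G (differential φ) y
      = ∑ b, ∑ d, (G y)⁻¹ b d * pd b (fun z => differential φ z d) y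
        - ∑ b, ∑ d, (G y)⁻¹ b d * ∑ e, christoffel G y e b d * differential φ y e := by
    simp only [divergence, covCovector, mul_sub, Finset.sum_sub_distrib]
  have e3 : ∑ b, ∑ d, (G y)⁻¹ b d * (differential φ y b * differential φ y d)
      = pairing (G y) (differential φ y) (differential φ y) := by
    rw [← sum_inv_mul_mul]
    simp only [mul_assoc]
  have e4 : ∑ b, ∑ d, (G y)⁻¹ b d * ricci G' y b d
      = ∑ b, ∑ d, (G y)⁻¹ b d * ricci G y b d - 2 * n * divergence G (differential φ) y
        - n * ((n : ℝ) - 1) * pairing (G y) (differential φ y) (differential φ y) := by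
    have e : ∀ b d, (G y)⁻¹ b d * ricci G' y b d = (G y)⁻¹ b d * ricci G y b d
        + (G y)⁻¹ b d * pd d (fun z => differential φ z b) y
        - n * ((G y)⁻¹ b d * pd b (fun z => differential φ z d) y)
        + ((n : ℝ) - 1) * ((G y)⁻¹ b d * ∑ e, christoffel G y e b d * differential φ y e)
        + ((n : ℝ) - 1) * ((G y)⁻¹ b d * (differential φ y b * differential φ y d))
        - (G y)⁻¹ b d * G y b d * (divergence G (differential φ) y
          + ((n : ℝ) - 1) * pairing (G y) (differential φ y) (differential φ y)) := fun b d => by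
      rw [h.ricci_eq hy]
      ring
    simp only [e, Finset.sum_add_distrib, Finset.sum_sub_distrib, ← Finset.mul_sum,
      ← Finset.sum_mul, hG.trace hy, e1, e3]
    linear_combination ((n : ℝ) - 1) * e2
  unfold schoutenTrace
  rw [h.sum_inv_eq hy, e4]
  field_simp

variable {f f' : Model n → ℝ} {w : ℝ}

theorem differential_eq (h : IsConformalOn K G G' φ) (hf : ContDiffOn ℝ ∞ f K)
    (hf' : ∀ z ∈ K, f' z = Real.exp (w * φ z) * f z) (hy : y ∈ K) (i : Fin (n + 1)) :
    differential f' y i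
      = Real.exp (w * φ y) * (differential f y i + w * f y * differential φ y i) := by
  have hr := h.metric.mem_range hy
  have hd := h.differentiable hy
  have hfd := h.metric.relOpen.differentiableWithinAt hf hy
  unfold differential
  rw [h.metric.relOpen.pd_congr hf' hy, pd_mul hr (hd.const_mul w).exp hfd,
    pd_exp hr (hd.const_mul w), pd_const_mul hr w hd]
  ring

/-- By `differential_eq`, df' = e^(wφ) (df + w f Υ), to which `divergence_eq` and the product rule
apply. The coefficient of Υ·df collects w from the exponential, w from d(w f), and n - 1 from the
change of connection. -/
theorem divergence_differential_eq (h : IsConformalOn K G G' φ) (hf : ContDiffOn ℝ ∞ f K)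
    (hf' : ∀ z ∈ K, f' z = Real.exp (w * φ z) * f z) (hy : y ∈ K) :
    divergence G' (differential f') y = Real.exp (-(2 * φ y)) * Real.exp (w * φ y) *
      (divergence G (differential f) y + w * f y * divergence G (differential φ) y
        + ((n : ℝ) - 1 + 2 * w) * pairing (G y) (differential φ y) (differential f y)
        + ((n : ℝ) - 1 + w) * w * f y
          * pairing (G y) (differential φ y) (differential φ y)) := by
  have hG := h.metric
  have hr := hG.mem_range hy
  have hφ := h.smooth_differential
  have hdf : ∀ i, ContDiffOn ℝ ∞ (fun z => differential f z i) K :=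
    fun i => hG.relOpen.contDiffOn_pd hf i
  have hwf : ContDiffOn ℝ ∞ (fun z => w * f z) K := contDiffOn_const.mul hf
  have hsum : ∀ i, ContDiffOn ℝ ∞
      (fun z => differential f z i + (w * f z) * differential φ z i) K :=
    fun i => (hdf i).add (hwf.mul (hφ i))
  have hwφ : ContDiffOn ℝ ∞ (fun z => w * φ z) K := contDiffOn_const.mul h.smooth
  have e : EqOn (differential f') (fun z i => Real.exp (w * φ z) *
      (differential f z i + (w * f z) * differential φ z i)) K := fun z hz => by
    funext i
    exact h.differential_eq hf hf' hz i
  have e1 : differential (fun z => Real.exp (w * φ z)) y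
      = fun i => (w * Real.exp (w * φ y)) * differential φ y i := by
    funext i
    have hd := h.differentiable hy
    unfold differential
    rw [pd_exp hr (hd.const_mul w), pd_const_mul hr w hd]
    ring
  have e2 : differential (fun z => w * f z) y = fun i => w * differential f y i := by
    funext i
    exact pd_const_mul hr w (hG.relOpen.differentiableWithinAt hf hy) i
  have e3 : differential f' y = fun i => Real.exp (w * φ y) *
      (differential f y i + (w * f y) * differential φ y i) := e hy
  rw [h.divergence_eq _ hy, e3, divergence_congr hG.relOpen e hy,
    hG.divergence_mul hwφ.exp hsum hy,
    hG.divergence_add hdf (fun i => hwf.mul (hφ i)) hy, hG.divergence_mul hwf hφ hy, e1, e2,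
    pairing_mul_left, hG.pairing_add_right hy, hG.pairing_mul_right hy, pairing_mul_left,
    pairing_mul_left, pairing_mul_left, pairing_add_left, pairing_mul_left,
    hG.pairing_comm hy (differential f y)]
  ring

/-- The conformal covariance of the Thomas operator on densities. -/
theorem thomasD_eq (hn : n ≠ 0) (h : IsConformalOn K G G' φ) (hf : ContDiffOn ℝ ∞ f K)
    (hf' : ∀ z ∈ K, f' z = Real.exp (w * φ z) * f z) (hy : y ∈ K) :
    thomasD G' (fun _ _ _ => 0) w f' y
      = Real.exp ((w - 1) * φ y) • tractorChange (G y) (Real.exp (φ y)) (differential φ y)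
          (thomasD G (fun _ _ _ => 0) w f y) := by
  have hG := h.metric
  have e1 : Real.exp (w * φ y) = Real.exp ((w - 1) * φ y) * Real.exp (φ y) := by
    rw [← Real.exp_add]
    ring_nf
  have e2 : Real.exp (-(2 * φ y)) = (Real.exp (φ y))⁻¹ * (Real.exp (φ y))⁻¹ := by
    rw [← Real.exp_neg, ← Real.exp_add]
    ring_nf
  have e3 := Real.exp_ne_zero (φ y)
  rw [thomasD_density, thomasD_density, tractorChange_eq, h.divergence_differential_eq hf hf' hy,
    h.schoutenTrace_eq hn hy, hf' y hy]
  funext α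
  rcases α with _ | a | _ <;> simp only [slots, topSlot, botSlot, Sum.elim_inl, Sum.elim_inr,
    Pi.smul_apply, smul_eq_mul]
  · rw [e1]
    ring
  · simp only [midSlot, Sum.elim_inl, Sum.elim_inr, h.differential_eq hf hf' hy, e1]
    ring
  · have e : midSlot (Sum.elim (fun _ : Unit => ((n : ℝ) - 1 + 2 * w) * w * f y)
        (Sum.elim (fun a => ((n : ℝ) - 1 + 2 * w) * differential f y a) fun _ : Unit =>
          -divergence G (differential f) y - w * schoutenTrace G y * f y))
        = fun a => ((n : ℝ) - 1 + 2 * w) * differential f y a := rfl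
    rw [e, hG.pairing_mul_right hy, e1, e2]
    field_simp
    ring

/-- The conformal covariance of `I^A D_A` on densities. -/
theorem scaleDotD_eq (hn : n ≠ 0) (h : IsConformalOn K G G' φ) {s s' : Model n → ℝ}
    (hs : ContDiffOn ℝ ∞ s K) (hs' : ∀ z ∈ K, s' z = Real.exp (φ z) * s z)
    (hf : ContDiffOn ℝ ∞ f K)
    (hf' : ∀ z ∈ K, f' z = Real.exp (w * φ z) * f z) (hy : y ∈ K) :
    scaleDotD G' s' (fun _ _ _ => 0) w f' y
      = Real.exp ((w - 1) * φ y) * scaleDotD G s (fun _ _ _ => 0) w f y := by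
  have hI : scaleTractor G' s' y
      = tractorChange (G y) (Real.exp (φ y)) (differential φ y) (scaleTractor G s y) := by
    unfold scaleTractor
    -- At weight one the exponent w - 1 vanishes, so I transforms without an extra factor.
    rw [h.thomasD_eq (w := 1) hn hs (by simpa using hs') hy, sub_self, zero_mul, Real.exp_zero,
      one_smul, tractorChange_eq, tractorChange_eq]
    have e : midSlot ((1 / ((n : ℝ) + 1)) • thomasD G (fun _ _ _ => 0) 1 s y)
        = fun a => (1 / ((n : ℝ) + 1)) * midSlot (thomasD G (fun _ _ _ => 0) 1 s y) a := rfl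
    rw [e, h.metric.pairing_mul_right hy]
    funext α
    rcases α with _ | a | _ <;> simp only [slots, topSlot, botSlot, Sum.elim_inl,
      Sum.elim_inr, Pi.smul_apply, smul_eq_mul] <;> ring
  have e : ∀ (c : ℝ) (U V : TIdx n → ℝ), tractorPair (G' y) U (c • V)
      = c * tractorPair (G' y) U V := fun c U V => by
    have e' : midSlot (c • V) = fun a => c * midSlot V a := rfl
    rw [tractorPair_eq, tractorPair_eq, e', h.isMetricOn.pairing_mul_right hy]
    simp only [topSlot, botSlot, Pi.smul_apply, smul_eq_mul]
    ring
  unfold scaleDotD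
  rw [hI, h.thomasD_eq hn hf hf' hy, e, h.tractorPair_tractorChange hy]

end IsConformalOn

/-- `I^A D_A` in the scale of an Einstein metric. -/
theorem scaleDotD_of_einstein (hn : n ≠ 0) (hG : IsMetricOn K G) (hy : y ∈ K)
    (hE : ∀ i j, ricci G y i j = -(n : ℝ) * G y i j) {s : Model n → ℝ} (hs : ∀ z ∈ K, s z = 1)
    (w : ℝ) (f : Model n → ℝ) :
    scaleDotD G s (fun _ _ _ => 0) w f y
      = laplacian G (fun _ _ _ => 0) f y + w * (n + w) * f y := by
  have hn' : (n : ℝ) ≠ 0 := Nat.cast_ne_zero.2 hn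
  have hn1 : (n : ℝ) + 1 ≠ 0 := by positivity
  have hds : ∀ z ∈ K, differential s z = fun _ => 0 := fun z hz => by
    funext i
    unfold differential
    rw [hG.relOpen.pd_congr (g := fun _ => (1 : ℝ)) hs hz, pd_const]
  have hdiv : divergence G (differential s) y = 0 := by
    rw [divergence_congr hG.relOpen (β := fun _ _ => (0 : ℝ)) hds hy]
    simp [divergence, covCovector, pd_const]
  -- Trace of Ric = -n g divided by 2n. The bottom slot of I is then -J/d = 1/2, and w d/2 + w
  -- (d+2w-2)/2 = w(n+w).
  have hJ : schoutenTrace G y = -((n : ℝ) + 1) / 2 := by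
    unfold schoutenTrace
    simp only [hE, ← mul_assoc, mul_comm _ (-(n : ℝ))]
    simp only [mul_assoc, ← Finset.mul_sum, hG.trace hy]
    field_simp
  unfold scaleDotD
  rw [scaleTractor_eq, thomasD_density, tractorPair_eq, hdiv, hJ, hds y hy, hs y hy,
    laplacian_eq_neg_divergence]
  have e : pairing (G y) (fun _ => 0) (fun a => ((n : ℝ) - 1 + 2 * w) * differential f y a) = 0 := by
    simp [pairing]
  simp only [slots, topSlot, botSlot, Sum.elim_inl, Sum.elim_inr]
  change _ + pairing (G y) (fun _ => 0) (fun a => ((n : ℝ) - 1 + 2 * w) * differential f y a) = _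
  rw [e]
  field_simp
  ring

end ThomasOperator

/-! ### Boundary behaviour of a defining function with |I|² = 1, and the Robin operator. -/

section BoundaryRobin

variable {n : ℕ} {K : Set (Model n)} {G : Model n → Matrix (Fin (n + 1)) (Fin (n + 1)) ℝ}
  {y : Model n}

theorem mem_range_iff {z : Model n} : z ∈ range (𝓡∂ (n + 1)) ↔ 0 ≤ z 0 := by
  rw [range_modelWithCornersEuclideanHalfSpace]
  rfl

theorem IsRelOpen.inter (hK : IsRelOpen K) {O : Set (Model n)} (hO : IsOpen O) :
    IsRelOpen (K ∩ O) :=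
  ⟨inter_subset_left.trans hK.1, fun z hz =>
    inter_mem (hK.2 z hz.1) (mem_nhdsWithin_of_mem_nhds (hO.mem_nhds hz.2))⟩

/-- Two continuous functions that agree in the open half-space agree up to the boundary. -/
theorem IsRelOpen.eqOn_of_interior (hK : IsRelOpen K) {f g : Model n → ℝ}
    (hf : ContinuousOn f K) (hg : ContinuousOn g K) (h : ∀ z ∈ K, 0 < z 0 → f z = g z) :
    EqOn f g K := by
  intro z hz
  -- The ray in the inward direction enters the open half-space at once, also from a boundary point.
  set γ : ℝ → Model n := fun t => z + t • EuclideanSpace.single 0 1 with hγ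
  have hz0 := mem_range_iff.1 (hK.1 hz)
  have hγ0 : ∀ t : ℝ, γ t 0 = z 0 + t := fun t => by simp [hγ]
  have hγK : ∀ᶠ t in 𝓝[>] (0 : ℝ), γ t ∈ K := by
    have hc : Tendsto γ (𝓝[>] 0) (𝓝[range (𝓡∂ (n + 1))] z) := by
      refine tendsto_nhdsWithin_iff.2 ⟨?_, ?_⟩
      · have : Continuous γ := by fun_prop
        have h0 : γ 0 = z := by simp [hγ]
        simpa [h0] using (this.tendsto 0).mono_left nhdsWithin_le_nhds
      · filter_upwards [self_mem_nhdsWithin] with t ht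
        rw [mem_range_iff, hγ0]
        exact add_nonneg hz0 (le_of_lt ht)
    exact hc (hK.2 z hz)
  have hc : Tendsto γ (𝓝[>] 0) (𝓝[K] z) := by
    refine tendsto_nhdsWithin_iff.2 ⟨?_, hγK⟩
    have : Continuous γ := by fun_prop
    have h0 : γ 0 = z := by simp [hγ]
    simpa [h0] using (this.tendsto 0).mono_left nhdsWithin_le_nhds
  refine tendsto_nhds_unique ((hf z hz).tendsto.comp hc)
    (((hg z hz).tendsto.comp hc).congr' ?_)
  filter_upwards [hγK, self_mem_nhdsWithin] with t ht ht'
  refine (h _ ht ?_).symm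
  rw [hγ0]
  exact add_pos_of_nonneg_of_pos hz0 ht'

/-- The tangential derivatives of a function that vanishes along the boundary vanish. -/
theorem IsRelOpen.pd_eq_zero (hK : IsRelOpen K) {f : Model n → ℝ} (hf : ContDiffOn ℝ ∞ f K)
    (hf0 : ∀ z ∈ K, z 0 = 0 → f z = 0) (hy : y ∈ K) (hy0 : y 0 = 0) {i : Fin (n + 1)}
    (hi : i ≠ 0) : pd i f y = 0 := by
  set B : Set (Model n) := {z | z 0 = 0}
  have hB : B ⊆ range (𝓡∂ (n + 1)) := fun z hz => mem_range_iff.2 (le_of_eq (Eq.symm hz))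
  -- Being constant on the hyperplane z₀ = 0 near `y`, `f` has a local minimum there on it. Both e_i
  -- and -e_i lie in the tangent cone of the hyperplane, so the derivative along e_i is zero.
  have hmin : IsLocalMinOn f B y := by
    filter_upwards [nhdsWithin_mono y hB (hK.2 y hy), self_mem_nhdsWithin] with z hz hz0
    rw [hf0 z hz hz0, hf0 y hy hy0]
  have hd := (hK.differentiableWithinAt hf hy).hasFDerivWithinAt.mono hB
  refine hmin.hasFDerivWithinAt_eq_zero hd ?_ ?_
  · refine mem_posTangentConeAt_of_segment_subset ?_
    rintro _ ⟨a, b, -, -, -, rfl⟩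
    simp [B, hy0, hi.symm]
  · refine mem_posTangentConeAt_of_segment_subset ?_
    rintro _ ⟨a, b, -, -, -, rfl⟩
    simp [B, hy0, hi.symm]

/-- `y` is a minimum of `f` on the half-space near `y`, and e_0 points into the half-space. This
fixes the sign of the conormal dσ. -/
theorem IsRelOpen.pd_nonneg (hK : IsRelOpen K) {f : Model n → ℝ} (hf : ContDiffOn ℝ ∞ f K)
    (hf0 : ∀ z ∈ K, 0 ≤ f z) (hy : y ∈ K) (hfy : f y = 0) : 0 ≤ pd 0 f y := by
  have hmin : IsLocalMinOn f (range (𝓡∂ (n + 1))) y := by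
    filter_upwards [hK.2 y hy] with z hz
    rw [hfy]
    exact hf0 z hz
  refine hmin.hasFDerivWithinAt_nonneg (hK.differentiableWithinAt hf hy).hasFDerivWithinAt ?_
  refine mem_posTangentConeAt_of_segment_subset ?_
  have hy0 := mem_range_iff.1 (hK.1 hy)
  rintro _ ⟨a, b, ha, hb, hab, rfl⟩
  rw [mem_range_iff]
  simp
  nlinarith

theorem IsMetricOn.smooth_ricci (hG : IsMetricOn K G) (a b : Fin (n + 1)) :
    ContDiffOn ℝ ∞ (fun z => ricci G z a b) K := by
  have hΓ := hG.smooth_christoffel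
  have hdΓ := fun k i j l => hG.relOpen.contDiffOn_pd (hΓ k i j) l
  exact ContDiffOn.sum fun c _ => ((hdΓ _ _ _ _).sub (hdΓ _ _ _ _)).add
    (ContDiffOn.sum fun e _ => ((hΓ _ _ _).mul (hΓ _ _ _)).sub ((hΓ _ _ _).mul (hΓ _ _ _)))

theorem IsMetricOn.smooth_schoutenTrace (hG : IsMetricOn K G) :
    ContDiffOn ℝ ∞ (schoutenTrace G) K :=
  (ContDiffOn.sum fun a _ => ContDiffOn.sum fun b _ =>
    (hG.smooth_inv a b).mul (hG.smooth_ricci a b)).div_const _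

theorem IsMetricOn.smooth_divergence (hG : IsMetricOn K G) {α : Model n → Fin (n + 1) → ℝ}
    (hα : ∀ i, ContDiffOn ℝ ∞ (fun z => α z i) K) : ContDiffOn ℝ ∞ (divergence G α) K :=
  ContDiffOn.sum fun i _ => ContDiffOn.sum fun j _ => (hG.smooth_inv i j).mul
    ((hG.relOpen.contDiffOn_pd (hα j) i).sub
      (ContDiffOn.sum fun k _ => (hG.smooth_christoffel k i j).mul (hα k)))

theorem IsMetricOn.smooth_pairing (hG : IsMetricOn K G) {α β : Model n → Fin (n + 1) → ℝ}
    (hα : ∀ i, ContDiffOn ℝ ∞ (fun z => α z i) K) (hβ : ∀ i, ContDiffOn ℝ ∞ (fun z => β z i) K) :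
    ContDiffOn ℝ ∞ (fun z => pairing (G z) (α z) (β z)) K :=
  ContDiffOn.sum fun i _ => (hα i).mul (hG.smooth_raise hβ i)

/-- The quantity α^b ∇_a α_b is written once through derivatives of α_k (`h4`) and once through
derivatives of α^k (`h3`). In the sum the Christoffel terms cancel and the product rule for α_k α^k
remains. -/
theorem IsMetricOn.pd_pairing_self (hG : IsMetricOn K G) {α : Model n → Fin (n + 1) → ℝ}
    (hα : ∀ i, ContDiffOn ℝ ∞ (fun z => α z i) K) (hy : y ∈ K) (a : Fin (n + 1)) :
    pd a (fun z => pairing (G z) (α z) (α z)) y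
      = 2 * ∑ b, raise (G y) (α y) b * covCovector G α y a b := by
  have hr := hG.mem_range hy
  have hαd := fun i => hG.relOpen.differentiableWithinAt (hα i) hy
  have hTd := fun c => hG.relOpen.differentiableWithinAt (hG.smooth_raise hα c) hy
  set T := raise (G y) (α y) with hT
  have h1 : pd a (fun z => pairing (G z) (α z) (α z)) y
      = ∑ k, pd a (fun z => α z k) y * T k
        + ∑ k, α y k * pd a (fun z => raise (G z) (α z) k) y := by
    unfold pairing
    rw [pd_sum (f := fun k z => α z k * raise (G z) (α z) k) _ hr
      fun k _ => (hαd k).mul (hTd k)]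
    simp only [pd_mul hr (hαd _) (hTd _), Finset.sum_add_distrib, hT]
  have h2 : ∀ X : Fin (n + 1) → ℝ, ∑ b, T b * ∑ k, G y b k * X k = ∑ k, α y k * X k := by
    intro X
    simp only [Finset.mul_sum]
    rw [Finset.sum_comm]
    refine Finset.sum_congr rfl fun k _ => ?_
    rw [← hG.sum_mul_raise hy (α y) k, Finset.sum_mul]
    exact Finset.sum_congr rfl fun b _ => by rw [hG.symm y hy b k]; ring
  have h3 : ∑ b, T b * covCovector G α y a b
      = ∑ e, α y e * ∑ k, christoffel G y e a k * T k
        + ∑ k, α y k * pd a (fun z => raise (G z) (α z) k) y := by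
    simp only [covCovector_eq hG hα hy, mul_add, Finset.sum_add_distrib]
    rw [← hT, h2, ← h2 fun e => ∑ k, christoffel G y e a k * T k]
    congr 1
    refine Finset.sum_congr rfl fun b _ => ?_
    congr 1
    simp only [Finset.mul_sum, Finset.sum_mul]
    rw [Finset.sum_comm]
    exact Finset.sum_congr rfl fun k _ => Finset.sum_congr rfl fun e _ => by ring
  have h4 : ∑ b, T b * covCovector G α y a b
      = ∑ k, pd a (fun z => α z k) y * T k - ∑ e, α y e * ∑ k, christoffel G y e a k * T k := by
    unfold covCovector
    simp only [mul_sub, Finset.sum_sub_distrib]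
    congr 1
    · exact Finset.sum_congr rfl fun b _ => mul_comm _ _
    · simp only [Finset.mul_sum]
      rw [Finset.sum_comm]
      exact Finset.sum_congr rfl fun k _ => Finset.sum_congr rfl fun e _ => by ring
  rw [h1, two_mul]
  nth_rw 1 [h4]
  rw [h3]
  ring

theorem meanCurvature_eq (G : Model n → Matrix (Fin (n + 1)) (Fin (n + 1)) ℝ)
    (ν : Model n → Fin (n + 1) → ℝ) (y : Model n) :
    meanCurvature G ν y = (1 / (n : ℝ)) * (divergence G ν y
      - ∑ i, ∑ j, raise (G y) (ν y) i * raise (G y) (ν y) j * covCovector G ν y i j) := rfl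

/-- The mean curvature depends only on the restriction of the unit conormal to the boundary. -/
theorem IsMetricOn.meanCurvature_congr (hG : IsMetricOn K G) {μ ν : Model n → Fin (n + 1) → ℝ}
    (hμ : ∀ i, ContDiffOn ℝ ∞ (fun z => μ z i) K) (hν : ∀ i, ContDiffOn ℝ ∞ (fun z => ν z i) K)
    (h : ∀ z ∈ K, z 0 = 0 → μ z = ν z) (hy : y ∈ K) (hy0 : y 0 = 0)
    (hν0 : ∀ i, i ≠ 0 → ν y i = 0) (hν1 : pairing (G y) (ν y) (ν y) = 1) :
    meanCurvature G μ y = meanCurvature G ν y := by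
  set m : Fin (n + 1) → ℝ := fun j => pd 0 (fun z => μ z j - ν z j) y
  have hcov : ∀ i j, covCovector G μ y i j
      = covCovector G ν y i j + if i = 0 then m j else 0 := by
    intro i j
    -- The difference of the two extensions vanishes along the boundary, so only its derivative in
    -- the direction e_0 survives.
    have e : pd i (fun z => μ z j - ν z j) y = if i = 0 then m j else 0 := by
      by_cases hi : i = 0
      · simp [hi, m]
      · rw [if_neg hi]
        exact hG.relOpen.pd_eq_zero ((hμ j).sub (hν j))
          (fun z hz hz0 => by rw [h z hz hz0, sub_self]) hy hy0 hi
    rw [pd_sub (hG.mem_range hy) (hG.relOpen.differentiableWithinAt (hμ j) hy)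
      (hG.relOpen.differentiableWithinAt (hν j) hy)] at e
    unfold covCovector
    rw [h y hy hy0, ← e]
    ring
  have hraise : ∀ k, raise (G y) (ν y) k = (G y)⁻¹ k 0 * ν y 0 := fun k =>
    Finset.sum_eq_single 0 (fun l _ hl => by rw [hν0 l hl, mul_zero]) (by simp)
  have hnorm : (G y)⁻¹ 0 0 * ν y 0 * ν y 0 = 1 := by
    rw [← hν1, pairing, Finset.sum_eq_single 0 (fun l _ hl => by rw [hν0 l hl, zero_mul])
      (by simp), hraise]
    ring
  rw [meanCurvature_eq, meanCurvature_eq, h y hy hy0]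
  congr 1
  unfold divergence
  simp only [hcov, mul_add, Finset.sum_add_distrib]
  have e1 : ∑ i, ∑ j, (G y)⁻¹ i j * (if i = 0 then m j else 0) = ∑ j, (G y)⁻¹ 0 j * m j :=
    (Finset.sum_eq_single 0 (fun i _ hi => by simp [hi]) (by simp)).trans (by simp)
  -- The normal term changes by the same amount as the divergence: its extra factor g^00 ν_0² is
  -- |ν|² = 1.
  have e2 : ∑ i, ∑ j, raise (G y) (ν y) i * raise (G y) (ν y) j * (if i = 0 then m j else 0)
      = ∑ j, (G y)⁻¹ 0 j * m j := by
    refine (Finset.sum_eq_single 0 (fun i _ hi => by simp [hi]) (by simp)).trans ?_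
    refine Finset.sum_congr rfl fun j _ => ?_
    rw [if_pos rfl, hraise, hraise, hG.inv_symm hy j 0]
    linear_combination ((G y)⁻¹ 0 j * m j) * hnorm
  rw [e1, e2]
  ring

/-- A defining function of the boundary whose scale tractor has length one. -/
structure IsUnitDefining (K : Set (Model n))
    (G : Model n → Matrix (Fin (n + 1)) (Fin (n + 1)) ℝ) (s : Model n → ℝ) : Prop where
  metric : IsMetricOn K G
  smooth : ContDiffOn ℝ ∞ s K
  nonneg : ∀ z ∈ K, 0 ≤ s z
  zero : ∀ z ∈ K, z 0 = 0 → s z = 0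
  unit : ∀ z ∈ K, 0 < z 0 → scaleDotD G s (fun _ _ _ => 0) 1 s z = (n : ℝ) + 1

namespace IsUnitDefining

variable {s : Model n → ℝ}

theorem mono (h : IsUnitDefining K G s) {K' : Set (Model n)} (hK' : IsRelOpen K') (hs : K' ⊆ K) :
    IsUnitDefining K' G s where
  metric := ⟨hK', fun i j => (h.metric.smooth i j).mono hs, fun z hz => h.metric.symm z (hs hz),
    fun z hz => h.metric.det z (hs hz)⟩
  smooth := h.smooth.mono hs
  nonneg z hz := h.nonneg z (hs hz)
  zero z hz := h.zero z (hs hz)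
  unit z hz := h.unit z (hs hz)

theorem smooth_differential (h : IsUnitDefining K G s) (i : Fin (n + 1)) :
    ContDiffOn ℝ ∞ (fun z => differential s z i) K := h.metric.relOpen.contDiffOn_pd h.smooth i

/-- This is |I|² = 1 solved for |dσ|². Given only in the interior, it extends to the boundary
because both sides are continuous on `K`. -/
theorem pairing_eq (h : IsUnitDefining K G s) (hy : y ∈ K) :
    pairing (G y) (differential s y) (differential s y)
      = 1 + 2 / ((n : ℝ) + 1) * (s y * (divergence G (differential s) y
        + schoutenTrace G y * s y)) := by
  have hG := h.metric
  have hs := h.smooth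
  have hds := h.smooth_differential
  refine hG.relOpen.eqOn_of_interior (hG.smooth_pairing hds hds).continuousOn
    (g := fun y => 1 + 2 / ((n : ℝ) + 1) * (s y * (divergence G (differential s) y
        + schoutenTrace G y * s y)))
    (contDiffOn_const.add (contDiffOn_const.mul (hs.mul ((hG.smooth_divergence hds).add
      (hG.smooth_schoutenTrace.mul hs))))).continuousOn (fun z hz hz0 => ?_) hy
  have hu := h.unit z hz hz0
  have hn1 : (n : ℝ) + 1 ≠ 0 := by positivity
  unfold scaleDotD at hu
  rw [scaleTractor_eq, thomasD_density, tractorPair_eq] at hu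
  simp only [slots, topSlot, botSlot, Sum.elim_inl, Sum.elim_inr] at hu
  change _ + pairing (G z) (differential s z)
    (fun a => ((n : ℝ) - 1 + 2 * 1) * differential s z a) = _ at hu
  rw [hG.pairing_mul_right hz] at hu
  field_simp
  field_simp at hu
  refine mul_left_cancel₀ hn1 ?_
  linear_combination hu

theorem pairing_eq_one (h : IsUnitDefining K G s) (hy : y ∈ K) (hy0 : y 0 = 0) :
    pairing (G y) (differential s y) (differential s y) = 1 := by
  rw [h.pairing_eq hy, h.zero y hy hy0]
  ring

theorem differential_eq_zero (h : IsUnitDefining K G s) (hy : y ∈ K) (hy0 : y 0 = 0)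
    {i : Fin (n + 1)} (hi : i ≠ 0) : differential s y i = 0 :=
  h.metric.relOpen.pd_eq_zero h.smooth h.zero hy hy0 hi

/-- The differential of `s` is the unit conormal along the boundary. -/
theorem differential_eq (h : IsUnitDefining K G s) (hy : y ∈ K) (hy0 : y 0 = 0)
    {α : Fin (n + 1) → ℝ} (hα : 0 < α 0) (hα0 : ∀ i, i ≠ 0 → α i = 0)
    (hα1 : pairing (G y) α α = 1) : differential s y = α := by
  have hsq : ∀ β : Fin (n + 1) → ℝ, (∀ i, i ≠ 0 → β i = 0) →
      pairing (G y) β β = (G y)⁻¹ 0 0 * β 0 ^ 2 := by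
    intro β hβ
    rw [pairing, Finset.sum_eq_single 0 (fun l _ hl => by rw [hβ l hl, zero_mul]) (by simp),
      raise, Finset.sum_eq_single 0 (fun l _ hl => by rw [hβ l hl, mul_zero]) (by simp)]
    ring
  have h0 := fun i hi => h.differential_eq_zero hy hy0 (i := i) hi
  have h1 := h.pairing_eq_one hy hy0
  rw [hsq _ h0] at h1
  rw [hsq _ hα0] at hα1
  have hpos : 0 ≤ differential s y 0 :=
    h.metric.relOpen.pd_nonneg h.smooth h.nonneg hy (h.zero y hy hy0)
  have hne : (G y)⁻¹ 0 0 ≠ 0 := fun h' => by simp [h'] at h1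
  -- Two multiples of dz₀ with the same length agree up to sign; the sign is settled by `hpos`.
  have hsq' : differential s y 0 ^ 2 = α 0 ^ 2 := mul_left_cancel₀ hne (h1.trans hα1.symm)
  funext i
  by_cases hi : i = 0
  · subst hi
    exact (pow_left_inj₀ hpos hα.le two_ne_zero).1 hsq'
  · rw [h0 i hi, hα0 i hi]

/-- Where σ = 0, the derivative of |dσ|² = 1 + (2/d) σ R is (2/d) R dσ, with R = ∇·dσ + Jσ.
Contracting with the unit normal gives σ^a σ^b ∇_a σ_b = (∇·dσ)/d, so nH = (1 - 1/d) ∇·dσ = (n/d)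
∇·dσ. -/
theorem meanCurvature_differential (hn : n ≠ 0) (h : IsUnitDefining K G s) (hy : y ∈ K)
    (hy0 : y 0 = 0) :
    meanCurvature G (differential s) y = divergence G (differential s) y / ((n : ℝ) + 1) := by
  have hG := h.metric
  have hr := hG.mem_range hy
  have hds := h.smooth_differential
  have hn' : (n : ℝ) ≠ 0 := Nat.cast_ne_zero.2 hn
  have hn1 : (n : ℝ) + 1 ≠ 0 := by positivity
  set R : Model n → ℝ := fun z => divergence G (differential s) z + schoutenTrace G z * s z
  have hR : ContDiffOn ℝ ∞ R K :=
    (hG.smooth_divergence hds).add (hG.smooth_schoutenTrace.mul h.smooth)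
  have hs0 := h.zero y hy hy0
  have hsd := hG.relOpen.differentiableWithinAt h.smooth hy
  have hRd := hG.relOpen.differentiableWithinAt hR hy
  have hRy : R y = divergence G (differential s) y := by simp [R, hs0]
  have hp : ∀ a, ∑ b, raise (G y) (differential s y) b * covCovector G (differential s) y a b
      = 1 / ((n : ℝ) + 1) * (differential s y a * divergence G (differential s) y) := by
    intro a
    have e1 := hG.pd_pairing_self hds hy a
    rw [hG.relOpen.pd_congr (fun z hz => h.pairing_eq hz) hy,
      pd_add (f := fun _ => 1) (g := fun z => 2 / ((n : ℝ) + 1) * (s z * R z)) hr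
        (differentiableWithinAt_const _) ((hsd.mul hRd).const_mul _), pd_const,
      pd_const_mul (f := fun z => s z * R z) hr _ (hsd.mul hRd), pd_mul hr hsd hRd, hs0, hRy] at e1
    unfold differential at e1 ⊢
    linear_combination (-1 / 2 : ℝ) * e1
  have hq : ∑ i, ∑ j, raise (G y) (differential s y) i * raise (G y) (differential s y) j
      * covCovector G (differential s) y i j = 1 / ((n : ℝ) + 1) * divergence G (differential s) y := by
    simp only [mul_assoc, ← Finset.mul_sum, hp]
    rw [← mul_one (1 / ((n : ℝ) + 1) * divergence G (differential s) y),
      ← h.pairing_eq_one hy hy0, pairing, Finset.mul_sum]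
    exact Finset.sum_congr rfl fun i _ => by ring
  rw [meanCurvature_eq, hq]
  field_simp
  ring

/-- Along the boundary `I^A D_A` is a multiple of the conformal Robin operator. -/
theorem scaleDotD_eq_robin (hn : n ≠ 0) (h : IsUnitDefining K G s) (hy : y ∈ K) (hy0 : y 0 = 0)
    {ν : Model n → Fin (n + 1) → ℝ} (hν : IsUnitConormalNear G ν y)
    {W : Type*} [NormedAddCommGroup W] [NormedSpace ℝ W] (A : Model n → Fin (n + 1) → W → W)
    (w : ℝ) (V : Model n → W) :
    scaleDotD G s A w V y = ((n : ℝ) + 1 + 2 * w - 2) • robin G A w ν V y := by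
  -- Shrink `K` until the properties of ν near `y` hold at all of its points.
  obtain ⟨O, hO, hyO, hOν⟩ := mem_nhdsWithin.1 (hν.1.and hν.2)
  have hK' := h.metric.relOpen.inter hO
  have h' := h.mono hK' inter_subset_left
  have hy' : y ∈ K ∩ O := ⟨hy, hyO⟩
  have hνs : ∀ i, ContDiffOn ℝ ∞ (fun z => ν z i) (K ∩ O) := fun i z hz =>
    (contDiffWithinAt_pi.1 (hOν ⟨hz.2, hK'.1 hz⟩).1 i).mono hK'.1
  have hν1 : ∀ z ∈ K ∩ O, z 0 = 0 → pairing (G z) (ν z) (ν z) = 1 := fun z hz hz0 => by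
    rw [← sum_inv_mul_mul]
    exact ((hOν ⟨hz.2, hK'.1 hz⟩).2 hz0).2.2
  have hds : ∀ z ∈ K ∩ O, z 0 = 0 → ν z = differential s z := fun z hz hz0 => by
    obtain ⟨e1, e2, -⟩ := (hOν ⟨hz.2, hK'.1 hz⟩).2 hz0
    exact (h'.differential_eq hz hz0 e1 e2 (hν1 z hz hz0)).symm
  have hH : meanCurvature G ν y = divergence G (differential s) y / ((n : ℝ) + 1) := by
    rw [← h.meanCurvature_differential hn hy hy0]
    exact h'.metric.meanCurvature_congr hνs h'.smooth_differential hds hy' hy0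
      (fun i hi => h.differential_eq_zero hy hy0 hi) (h.pairing_eq_one hy hy0)
  unfold scaleDotD robin
  rw [scaleTractor_eq, hH, hds y hy' hy0, h.zero y hy hy0]
  -- With I = (0, ν, -H) the bottom slot of Du, which holds the Laplacian, is multiplied by zero.
  -- Only first coupled derivatives are left, so the connection form may be arbitrary.
  simp only [tractorPair, thomasD, slots, topSlot, botSlot, midSlot, Sum.elim_inl, Sum.elim_inr,
    zero_smul, zero_add, mul_zero, add_zero]
  rw [smul_sub, Finset.smul_sum]
  simp only [Finset.smul_sum, smul_smul]
  rw [add_comm]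
  refine (congrArg₂ (· + ·) ?_ ?_).trans (sub_eq_add_neg _ _).symm
  · exact Finset.sum_congr rfl fun a _ => Finset.sum_congr rfl fun b _ => by
      rw [mul_comm]
  · rw [← neg_smul]
    congr 1
    ring

end IsUnitDefining

end BoundaryRobin

/-! ### From metrics on the manifold to metric matrices in a chart. -/

section MetricInChart

variable {n : ℕ} {M : Type*} [TopologicalSpace M]
  [ChartedSpace (EuclideanHalfSpace (n + 1)) M]

/-- The image of `U` in the chart at `x`. -/
def chartDomain (U : Set M) (x : M) : Set (Model n) :=
  (extChartAt (𝓡∂ (n + 1)) x).target ∩ (extChartAt (𝓡∂ (n + 1)) x).symm ⁻¹' U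

theorem mem_chartDomain {U : Set M} {x p : M}
    (hp : p ∈ U ∩ (extChartAt (𝓡∂ (n + 1)) x).source) :
    extChartAt (𝓡∂ (n + 1)) x p ∈ chartDomain U x := by
  refine ⟨(extChartAt (𝓡∂ (n + 1)) x).map_source hp.2, ?_⟩
  rw [mem_preimage, (extChartAt (𝓡∂ (n + 1)) x).left_inv hp.2]
  exact hp.1

theorem isRelOpen_chartDomain {U : Set M} (hU : IsOpen U) (x : M) :
    IsRelOpen (chartDomain (n := n) U x) := by
  refine ⟨fun z hz => extChartAt_target_subset_range x hz.1, fun z hz => ?_⟩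
  have hx := extChartAt_target_mem_nhdsWithin_of_mem hz.1
  refine inter_mem hx ?_
  have h := (continuousOn_extChartAt_symm (I := 𝓡∂ (n + 1)) x z hz.1).preimage_mem_nhdsWithin
    (hU.mem_nhds hz.2)
  exact nhdsWithin_le_iff.2 hx h

theorem metricMat_smul {g g' : ∀ p : M, Bil n p} (x : M) {z : Model n} {t : ℝ}
    (h : g' ((extChartAt (𝓡∂ (n + 1)) x).symm z)
      = t • g ((extChartAt (𝓡∂ (n + 1)) x).symm z)) :
    metricMat g' x z = t • metricMat g x z := by
  ext i j
  simp only [metricMat, Matrix.of_apply, Matrix.smul_apply, smul_eq_mul, h,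
    FunLike.coe_smul, Pi.smul_apply]

variable [IsManifold (𝓡∂ (n + 1)) ∞ M]

theorem contDiffOn_comp_symm {U : Set M} {f : M → ℝ}
    (hf : ContMDiffOn (𝓡∂ (n + 1)) 𝓘(ℝ, ℝ) ∞ f U) (x : M) :
    ContDiffOn ℝ ∞ (fun z => f ((extChartAt (𝓡∂ (n + 1)) x).symm z)) (chartDomain U x) :=
  contMDiffOn_iff_contDiffOn.1 (hf.comp
    ((contMDiffOn_extChartAt_symm x).mono inter_subset_left) fun _ hz => hz.2)

/-- The coordinate frame is the frame of the tangent bundle trivialisation at `x`; in this form,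
smoothness and positivity can be read off from the bundle. -/
theorem metricMat_apply (g : ∀ p : M, Bil n p) (x : M) {z : Model n}
    (hz : z ∈ (extChartAt (𝓡∂ (n + 1)) x).target) (i j : Fin (n + 1)) :
    metricMat g x z i j = g ((extChartAt (𝓡∂ (n + 1)) x).symm z)
      ((trivializationAt (Model n) (TangentSpace (𝓡∂ (n + 1))) x).symmL ℝ
        ((extChartAt (𝓡∂ (n + 1)) x).symm z) (EuclideanSpace.single i 1))
      ((trivializationAt (Model n) (TangentSpace (𝓡∂ (n + 1))) x).symmL ℝ
        ((extChartAt (𝓡∂ (n + 1)) x).symm z) (EuclideanSpace.single j 1)) := by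
  have : IsManifold (𝓡∂ (n + 1)) 1 M := IsManifold.of_le (n := ∞) (by simp)
  have hx : (extChartAt (𝓡∂ (n + 1)) x).symm z ∈ (chartAt (EuclideanHalfSpace (n + 1)) x).source := by
    rw [← extChartAt_source (𝓡∂ (n + 1))]
    exact (extChartAt (𝓡∂ (n + 1)) x).map_target hz
  have h := TangentBundle.symmL_trivializationAt (I := 𝓡∂ (n + 1)) (𝕜 := ℝ) (E := Model n) hx
  rw [(extChartAt (𝓡∂ (n + 1)) x).right_inv hz] at h
  rw [h]
  rfl

theorem contMDiffOn_symmL (x : M) (v : Model n) :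
    ContMDiffOn (𝓡∂ (n + 1)) ((𝓡∂ (n + 1)).prod 𝓘(ℝ, Model n)) ∞
      (fun p : M => TotalSpace.mk' (Model n) (E := TangentSpace (𝓡∂ (n + 1))) p
        ((trivializationAt (Model n) (TangentSpace (𝓡∂ (n + 1))) x).symmL ℝ p v))
      (chartAt (EuclideanHalfSpace (n + 1)) x).source := by
  set e := trivializationAt (Model n) (TangentSpace (𝓡∂ (n + 1)) : M → Type _) x
  refine (e.contMDiffOn_section_baseSet_iff (IB := 𝓡∂ (n + 1)) (n := ∞)).2
    ((contMDiffOn_const (c := v)).congr fun p hp => ?_)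
  rw [Trivialization.symmL_apply (hb := hp)]
  exact congrArg Prod.snd (e.apply_mk_symm hp v)

variable {c : ConformalStructure n M} {U : Set M}

theorem contMDiffOn_apply_symmL {g : ∀ p : M, Bil n p} (hg : IsScaleOn c U g) (x : M)
    (v v' : Model n) :
    ContMDiffOn (𝓡∂ (n + 1)) 𝓘(ℝ, ℝ) ∞ (fun p => g p
      ((trivializationAt (Model n) (TangentSpace (𝓡∂ (n + 1))) x).symmL ℝ p v)
      ((trivializationAt (Model n) (TangentSpace (𝓡∂ (n + 1))) x).symmL ℝ p v'))
      (U ∩ (chartAt (EuclideanHalfSpace (n + 1)) x).source) := by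
  intro p hp
  have h : ContMDiffWithinAt (𝓡∂ (n + 1)) ((𝓡∂ (n + 1)).prod 𝓘(ℝ)) ∞
      (fun p : M => TotalSpace.mk' ℝ (E := Bundle.Trivial M ℝ) p (g p
      ((trivializationAt (Model n) (TangentSpace (𝓡∂ (n + 1))) x).symmL ℝ p v)
      ((trivializationAt (Model n) (TangentSpace (𝓡∂ (n + 1))) x).symmL ℝ p v')))
      (U ∩ (chartAt (EuclideanHalfSpace (n + 1)) x).source) p := by
    apply ContMDiffWithinAt.clm_bundle_apply₂ (F₁ := Model n) (F₂ := Model n)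
    · exact (hg.2.mono inter_subset_left) p hp
    · exact ((contMDiffOn_symmL x v).mono inter_subset_right) p hp
    · exact ((contMDiffOn_symmL x v').mono inter_subset_right) p hp
  simp only [contMDiffWithinAt_totalSpace] at h
  exact h.2

theorem symmL_ne_zero {x p : M} (hp : p ∈ (chartAt (EuclideanHalfSpace (n + 1)) x).source)
    {v : Model n} (hv : v ≠ 0) :
    (trivializationAt (Model n) (TangentSpace (𝓡∂ (n + 1))) x).symmL ℝ p v ≠ 0 := by
  set e := trivializationAt (Model n) (TangentSpace (𝓡∂ (n + 1)) : M → Type _) x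
  have hp' : p ∈ e.baseSet := hp
  intro h
  apply hv
  rw [← e.continuousLinearMapAt_symmL (R := ℝ) hp' v, h, map_zero]

theorem exists_inner_of_mem (c : ConformalStructure n M) {p : M} {h : Bil n p} (hp : h ∈ c.Q p) :
    (∀ v v', h v v' = h v' v) ∧ ∀ v, v ≠ 0 → 0 < h v v := by
  obtain ⟨g₀, hg₀⟩ := c.exists_metric
  obtain ⟨t, ht, rfl⟩ := (hg₀ p h).1 hp
  refine ⟨fun v v' => ?_, fun v hv => ?_⟩
  · simp only [FunLike.coe_smul, Pi.smul_apply, g₀.symm p v v']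
  · simp only [FunLike.coe_smul, Pi.smul_apply]
    exact mul_pos ht (g₀.pos p v hv)

theorem isMetricOn_metricMat {g : ∀ p : M, Bil n p} (hU : IsOpen U) (hg : IsScaleOn c U g) (x : M) :
    IsMetricOn (chartDomain U x) (metricMat g x) where
  relOpen := isRelOpen_chartDomain hU x
  smooth i j := by
    have h := contDiffOn_comp_symm
      (contMDiffOn_apply_symmL hg x (EuclideanSpace.single i 1) (EuclideanSpace.single j 1)) x
    refine (h.mono fun z hz => ⟨hz.1, hz.2, ?_⟩).congr fun z hz => metricMat_apply g x hz.1 i j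
    rw [← extChartAt_source (𝓡∂ (n + 1))]
    exact (extChartAt (𝓡∂ (n + 1)) x).map_target hz.1
  symm z hz i j := by
    rw [metricMat_apply g x hz.1, metricMat_apply g x hz.1]
    exact (exists_inner_of_mem c (hg.1 _ hz.2)).1 _ _
  det z hz := by
    have hsrc : (extChartAt (𝓡∂ (n + 1)) x).symm z
        ∈ (chartAt (EuclideanHalfSpace (n + 1)) x).source := by
      rw [← extChartAt_source (𝓡∂ (n + 1))]
      exact (extChartAt (𝓡∂ (n + 1)) x).map_target hz.1
    obtain ⟨hsymm, hpos⟩ := exists_inner_of_mem c (hg.1 _ hz.2)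
    -- A kernel vector of the matrix would be a nonzero tangent vector orthogonal to the whole
    -- frame, hence to itself, against positivity.
    by_contra hdet
    rw [isUnit_iff_ne_zero, not_not] at hdet
    obtain ⟨v, hv, hGv⟩ := Matrix.exists_mulVec_eq_zero_iff.2 hdet
    set L := (trivializationAt (Model n) (TangentSpace (𝓡∂ (n + 1))) x).symmL ℝ
      ((extChartAt (𝓡∂ (n + 1)) x).symm z)
    set V : Model n := ∑ i, v i • EuclideanSpace.single i 1
    have hV : V ≠ 0 := by
      intro h
      apply hv
      funext i
      have := congrArg (fun u : Model n => u i) h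
      simpa [V, Finset.sum_apply, Pi.single_apply] using this
    refine (hpos (L V) (symmL_ne_zero hsrc hV)).ne' ?_
    have e : ∀ i, g ((extChartAt (𝓡∂ (n + 1)) x).symm z) (L (EuclideanSpace.single i 1)) (L V)
        = 0 := by
      intro i
      have := congrFun hGv i
      simp only [Matrix.mulVec, dotProduct, metricMat_apply g x hz.1, Pi.zero_apply] at this
      simp only [V, map_sum, map_smul, smul_eq_mul]
      rw [← this]
      exact Finset.sum_congr rfl fun j _ => mul_comm _ _
    have hLV : L V = ∑ i, v i • L (EuclideanSpace.single i 1) := by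
      simp only [V, map_sum, map_smul]
    conv_lhs => arg 2; rw [hLV]
    rw [map_sum]
    refine Finset.sum_eq_zero fun i _ => ?_
    rw [map_smul, hsymm, e, smul_zero]

end MetricInChart

/-! ### Scales, densities and boundary points in a chart. -/

section ScalesInChart

variable {n : ℕ} {M : Type*} [TopologicalSpace M]
  [ChartedSpace (EuclideanHalfSpace (n + 1)) M] [IsManifold (𝓡∂ (n + 1)) ∞ M]
  {c : ConformalStructure n M} {U : Set M} {g g' : ∀ p : M, Bil n p} {Ω : M → ℝ}

theorem IsScaleOn.mono (hg : IsScaleOn c U g) {U' : Set M} (h : U' ⊆ U) : IsScaleOn c U' g :=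
  ⟨fun p hp => hg.1 p (h hp), hg.2.mono h⟩

theorem metricMat_pos (hg : IsScaleOn c U g) (x : M) {z : Model n} (hz : z ∈ chartDomain U x)
    (i : Fin (n + 1)) : 0 < metricMat g x z i i := by
  have hsrc : (extChartAt (𝓡∂ (n + 1)) x).symm z
      ∈ (chartAt (EuclideanHalfSpace (n + 1)) x).source := by
    rw [← extChartAt_source (𝓡∂ (n + 1))]
    exact (extChartAt (𝓡∂ (n + 1)) x).map_target hz.1
  rw [metricMat_apply g x hz.1]
  exact (exists_inner_of_mem c (hg.1 _ hz.2)).2 _ (symmL_ne_zero hsrc (by simp))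

/-- The logarithm of the conformal factor, read in the chart at `x`. -/
def logFactor (Ω : M → ℝ) (x : M) (z : Model n) : ℝ :=
  Real.log (Ω ((extChartAt (𝓡∂ (n + 1)) x).symm z))

/-- Smoothness of log Ω is an input because it has two sources: the smoothness of both scales
(`contDiffOn_logFactor`), or that of σ when the second metric is g₊. -/
theorem isConformalOn_metricMat (hU : IsOpen U) (hg : IsScaleOn c U g)
    (hΩ : ∀ p ∈ U, 0 < Ω p ∧ g' p = (Ω p) ^ 2 • g p) (x : M)
    (hs : ContDiffOn ℝ ∞ (logFactor Ω x) (chartDomain (n := n) U x)) :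
    IsConformalOn (chartDomain U x) (metricMat g x) (metricMat g' x) (logFactor Ω x) where
  metric := isMetricOn_metricMat hU hg x
  smooth := hs
  eq z hz := by
    obtain ⟨h0, h1⟩ := hΩ _ hz.2
    rw [metricMat_smul x h1, logFactor, two_mul, Real.exp_add, Real.exp_log h0, sq]

/-- Ω is recovered from a diagonal entry: Ω² = g'_00 / g_00, a quotient of positive smooth
functions. -/
theorem contDiffOn_logFactor (hU : IsOpen U) (hg : IsScaleOn c U g) (hg' : IsScaleOn c U g')
    (hΩ : ∀ p ∈ U, 0 < Ω p ∧ g' p = (Ω p) ^ 2 • g p) (x : M) :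
    ContDiffOn ℝ ∞ (logFactor Ω x) (chartDomain (n := n) U x) := by
  have hG := isMetricOn_metricMat hU hg x
  have hG' := isMetricOn_metricMat hU hg' x
  have hpos : ∀ z ∈ chartDomain (n := n) U x, metricMat g x z 0 0 ≠ 0 :=
    fun z hz => (metricMat_pos hg x hz 0).ne'
  have hpos' : ∀ z ∈ chartDomain (n := n) U x, metricMat g' x z 0 0 ≠ 0 :=
    fun z hz => (metricMat_pos hg' x hz 0).ne'
  refine (contDiffOn_const (c := (1 / 2 : ℝ))).mul
    (((hG'.smooth 0 0).div (hG.smooth 0 0) hpos).log fun z hz =>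
      div_ne_zero (hpos' z hz) (hpos z hz)) |>.congr fun z hz => ?_
  obtain ⟨h0, h1⟩ := hΩ _ hz.2
  change _ = 1 / 2 * Real.log (metricMat g' x z 0 0 / metricMat g x z 0 0)
  rw [metricMat_smul x h1, Matrix.smul_apply, smul_eq_mul, mul_div_assoc, div_self (hpos z hz),
    mul_one, Real.log_pow, logFactor]
  push_cast
  ring

theorem Density.inScale_eq {V : Set M} {w : ℝ} (u : Density c V w) {p : M} (hp : p ∈ V)
    (hg : g p ∈ c.Q p) (hΩ : 0 < Ω p) (h : g' p = (Ω p) ^ 2 • g p) :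
    u.inScale g' p = (Ω p) ^ w * u.inScale g p := by
  unfold Density.inScale
  rw [h, u.homog p hp _ hg _ (by positivity), ← Real.rpow_natCast, ← Real.rpow_mul hΩ.le]
  congr 2
  push_cast
  ring

theorem Density.inChart_eq {w : ℝ} (u : Density c U w) (hg : IsScaleOn c U g)
    (hΩ : ∀ p ∈ U, 0 < Ω p ∧ g' p = (Ω p) ^ 2 • g p) (x : M) {z : Model n}
    (hz : z ∈ chartDomain U x) :
    u.inChart g' x z = Real.exp (w * logFactor Ω x z) * u.inChart g x z := by
  obtain ⟨h0, h1⟩ := hΩ _ hz.2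
  unfold Density.inChart
  rw [u.inScale_eq hz.2 (hg.1 _ hz.2) h0 h1, Real.rpow_def_of_pos h0, mul_comm w]
  rfl

theorem Density.contDiffOn_inChart {w : ℝ} (u : Density c U w) (hg : IsScaleOn c U g) (x : M) :
    ContDiffOn ℝ ∞ (u.inChart g x) (chartDomain U x) :=
  contDiffOn_comp_symm (u.smooth g hg) x

theorem exists_scale (c : ConformalStructure n M) :
    ∃ g₀ : ∀ p : M, Bil n p, IsScaleOn c univ g₀ ∧
      ∀ (p : M) (h : Bil n p), h ∈ c.Q p → ∃ t : ℝ, 0 < t ∧ h = t ^ 2 • g₀ p := by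
  obtain ⟨g₀, hg₀⟩ := c.exists_metric
  refine ⟨g₀.inner, ⟨fun p _ => (hg₀ p _).2 ⟨1, one_pos, (one_smul _ _).symm⟩,
    g₀.contMDiff.contMDiffOn⟩, fun p h hp => ?_⟩
  obtain ⟨t, ht, rfl⟩ := (hg₀ p h).1 hp
  exact ⟨√t, Real.sqrt_pos.2 ht, by rw [Real.sq_sqrt ht.le]⟩

/-- Two elements of a ray are related by a positive factor. -/
theorem ConformalStructure.exists_factor (c : ConformalStructure n M) {p : M} {h h' : Bil n p}
    (hp : h ∈ c.Q p) (hp' : h' ∈ c.Q p) : ∃ t : ℝ, 0 < t ∧ h' = t ^ 2 • h := by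
  obtain ⟨g₀, -, hg₀⟩ := exists_scale c
  obtain ⟨a, ha, rfl⟩ := hg₀ p h hp
  obtain ⟨b, hb, rfl⟩ := hg₀ p h' hp'
  refine ⟨b / a, div_pos hb ha, ?_⟩
  rw [smul_smul, ← mul_pow, div_mul_cancel₀ _ ha.ne']

/-- A global density is smooth in every local scale. -/
theorem Density.contDiffOn_inChart_of_univ {w : ℝ} (u : Density c univ w) (hU : IsOpen U)
    (hg : IsScaleOn c U g) (x : M) :
    ContDiffOn ℝ ∞ (u.inChart g x) (chartDomain U x) := by
  -- A density over `univ` is tested on global scales only, so the local scale is compared with a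
  -- global one on `U`.
  obtain ⟨g₀, hs, hg₀⟩ := exists_scale c
  have hex : ∀ p, ∃ t : ℝ, p ∈ U → 0 < t ∧ g p = t ^ 2 • g₀ p := fun p => by
    by_cases hp : p ∈ U
    · obtain ⟨t, ht⟩ := hg₀ p _ (hg.1 p hp)
      exact ⟨t, fun _ => ht⟩
    · exact ⟨0, fun h => absurd h hp⟩
  choose Ω hΩ using hex
  have hs' := hs.mono (subset_univ U)
  refine ((contDiffOn_const (c := w)).mul (contDiffOn_logFactor hU hs' hg hΩ x)).exp.mul
    ((u.contDiffOn_inChart hs x).mono fun z hz => ⟨hz.1, mem_univ _⟩) |>.congr fun z hz => ?_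
  obtain ⟨h0, h1⟩ := hΩ _ hz.2
  unfold Density.inChart
  rw [u.inScale_eq (mem_univ _) (hs.1 _ (mem_univ _)) h0 h1, Real.rpow_def_of_pos h0, mul_comm w]
  rfl

/-- Interior points may be recognised in any chart of the atlas, and the target of a chart is a
neighbourhood of its points relative to the half-space. -/
theorem mem_interior_iff {x : M} {z : Model n} (hz : z ∈ (extChartAt (𝓡∂ (n + 1)) x).target) :
    (extChartAt (𝓡∂ (n + 1)) x).symm z ∈ (𝓡∂ (n + 1)).interior M ↔ 0 < z 0 := by
  have h1 : IsManifold (𝓡∂ (n + 1)) 1 M := IsManifold.of_le (n := ∞) (by simp)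
  have hsrc : (extChartAt (𝓡∂ (n + 1)) x).symm z
      ∈ (chartAt (EuclideanHalfSpace (n + 1)) x).source := by
    rw [← extChartAt_source (𝓡∂ (n + 1))]
    exact (extChartAt (𝓡∂ (n + 1)) x).map_target hz
  refine ((𝓡∂ (n + 1)).isInteriorPoint_iff_of_mem_atlas one_ne_zero
    (chart_mem_atlas _ x) hsrc).trans ?_
  change extChartAt (𝓡∂ (n + 1)) x _ ∈ interior (extChartAt (𝓡∂ (n + 1)) x).target ↔ _
  rw [(extChartAt (𝓡∂ (n + 1)) x).right_inv hz]
  have hint := interior_range_modelWithCornersEuclideanHalfSpace (n + 1)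
  constructor
  · intro h
    have := interior_mono (extChartAt_target_subset_range x) h
    rw [hint] at this
    exact this
  · intro h
    have hr : range (𝓡∂ (n + 1)) ∈ 𝓝 z := by
      rw [mem_nhds_iff]
      exact ⟨_, interior_subset, isOpen_interior, by rw [hint]; exact h⟩
    rw [mem_interior_iff_mem_nhds]
    have h2 := extChartAt_target_mem_nhdsWithin_of_mem hz
    rwa [nhdsWithin_eq_nhds.2 hr] at h2

theorem mem_boundary_iff {x : M} {z : Model n} (hz : z ∈ (extChartAt (𝓡∂ (n + 1)) x).target) :
    (extChartAt (𝓡∂ (n + 1)) x).symm z ∈ (𝓡∂ (n + 1)).boundary M ↔ z 0 = 0 := by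
  have h0 : 0 ≤ z 0 := mem_range_iff.1 (extChartAt_target_subset_range x hz)
  rw [← (𝓡∂ (n + 1)).compl_interior, mem_compl_iff, mem_interior_iff hz, not_lt]
  exact ⟨fun h => le_antisymm h h0, fun h => h.le⟩

/-! ### The scattering Laplacian, and |I|² = 1 as its consequence. -/

section Scattering

variable {σ : Density c univ 1}

theorem IsPoincareEinstein.nonneg (hσ : IsPoincareEinstein c σ) {p : M} {h : Bil n p}
    (hp : h ∈ c.Q p) : 0 ≤ σ.toFun p h := by
  rcases (𝓡∂ (n + 1)).isInteriorPoint_or_isBoundaryPoint p with hi | hb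
  · exact (hσ.pos p hi h hp).le
  · exact (hσ.zero p hb h hp).ge

/-- The scattering Laplacian in a chart, on a function `f` that represents a density of weight `w`
in the scale `g` and that becomes `f'` in the scale `g₊`. -/
theorem IsPoincareEinstein.scattering (hn : n ≠ 0) (hσ : IsPoincareEinstein c σ)
    {gp : ∀ p : M, Bil n p} (hgp : IsMetricOf σ ((𝓡∂ (n + 1)).interior M) gp) (hU : IsOpen U)
    (hUi : U ⊆ (𝓡∂ (n + 1)).interior M) (hg : IsScaleOn c U g) (x : M) {w : ℝ}
    {f f' : Model n → ℝ} (hf : ContDiffOn ℝ ∞ f (chartDomain U x))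
    (hf' : ∀ z ∈ chartDomain U x, f' z = ((σ.inChart g x z)⁻¹) ^ w * f z)
    {y : Model n} (hy : y ∈ chartDomain U x) :
    σ.inChart g x y * scaleDotD (metricMat g x) (σ.inChart g x) (fun _ _ _ => 0) w f y
      = (σ.inChart g x y) ^ w * (laplacian (metricMat gp x) (fun _ _ _ => 0) f' y
        + w * (n + w) * f' y) := by
  set Ω : M → ℝ := fun p => (σ.inScale g p)⁻¹
  have hpos : ∀ p ∈ U, 0 < σ.inScale g p := fun p hp => hσ.pos p (hUi hp) _ (hg.1 p hp)
  have hΩ : ∀ p ∈ U, 0 < Ω p ∧ gp p = (Ω p) ^ 2 • g p := by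
    intro p hp
    refine ⟨inv_pos.2 (hpos p hp), ?_⟩
    obtain ⟨h1, h2⟩ := hgp p (hUi hp)
    obtain ⟨t, ht, h3⟩ := c.exists_factor (hg.1 p hp) h1
    rw [σ.inScale_eq (Ω := fun _ => t) (mem_univ p) (hg.1 p hp) ht h3, Real.rpow_one] at h2
    rw [h3, eq_inv_of_mul_eq_one_left h2]
  have hσs := σ.contDiffOn_inChart_of_univ hU hg x
  have hpos' : ∀ z ∈ chartDomain U x, 0 < σ.inChart g x z := fun z hz => hpos _ hz.2
  -- `IsMetricOf` fixes g₊ only pointwise; the smoothness of the factor Ω = σ⁻¹ comes from σ.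
  have hlog : ContDiffOn ℝ ∞ (logFactor Ω x) (chartDomain (n := n) U x) :=
    (hσs.inv fun z hz => (hpos' z hz).ne').log fun z hz => (inv_pos.2 (hpos' z hz)).ne'
  have hc := isConformalOn_metricMat hU hg hΩ x hlog
  have hexp : ∀ (a : ℝ), ∀ z ∈ chartDomain U x,
      Real.exp (a * logFactor Ω x z) = ((σ.inChart g x z)⁻¹) ^ a := fun a z hz => by
    rw [Real.rpow_def_of_pos (inv_pos.2 (hpos' z hz)), mul_comm a]
    rfl
  have hE : ∀ i j, ricci (metricMat gp x) y i j = -(n : ℝ) * metricMat gp x y i j := by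
    intro i j
    have := hσ.einstein gp hgp x _ ⟨hUi hy.2, (extChartAt (𝓡∂ (n + 1)) x).map_target hy.1⟩ i j
    rwa [(extChartAt (𝓡∂ (n + 1)) x).right_inv hy.1] at this
  have h1 := hc.scaleDotD_eq hn hσs (s' := fun _ => 1) (f' := f') (w := w) (fun z hz => by
    have := hexp 1 z hz
    rw [one_mul, Real.rpow_one] at this
    rw [this, inv_mul_cancel₀ (hpos' z hz).ne']) hf
    (fun z hz => by rw [hf' z hz, hexp w z hz]) hy
  rw [scaleDotD_of_einstein hn hc.isMetricOn hy hE (fun _ _ => rfl), hexp _ y hy] at h1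
  have hy0 := hpos' y hy
  rw [h1, ← mul_assoc, Real.inv_rpow hy0.le, ← Real.rpow_neg hy0.le, ← Real.rpow_add hy0,
    show w + -(w - 1) = 1 by ring, Real.rpow_one]

/-- Rescaling any metric of the class by σ⁻² makes σ equal to 1. Some g₊ is needed to extract |I|² =
1, a statement that does not mention it. -/
theorem IsPoincareEinstein.exists_metric (hσ : IsPoincareEinstein c σ) :
    ∃ gp : ∀ p : M, Bil n p, IsMetricOf σ ((𝓡∂ (n + 1)).interior M) gp := by
  obtain ⟨g₀, hg₀⟩ := c.exists_metric
  have hQ : ∀ p, g₀.inner p ∈ c.Q p := fun p => (hg₀ p _).2 ⟨1, one_pos, (one_smul _ _).symm⟩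
  refine ⟨fun p => ((σ.inScale g₀.inner p)⁻¹) ^ 2 • g₀.inner p, fun p hp => ?_⟩
  have hpos : 0 < σ.inScale g₀.inner p := hσ.pos p hp _ (hQ p)
  refine ⟨(hg₀ p _).2 ⟨_, by positivity, rfl⟩, ?_⟩
  rw [σ.inScale_eq (g := g₀.inner) (Ω := fun p => (σ.inScale g₀.inner p)⁻¹) (mem_univ p) (hQ p)
    (inv_pos.2 hpos) rfl, Real.rpow_one, inv_mul_cancel₀ hpos.ne']

theorem IsPoincareEinstein.isUnitDefining (hn : n ≠ 0) (hσ : IsPoincareEinstein c σ)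
    (hU : IsOpen U) (hg : IsScaleOn c U g) (x : M) :
    IsUnitDefining (chartDomain U x) (metricMat g x) (σ.inChart g x) where
  metric := isMetricOn_metricMat hU hg x
  smooth := σ.contDiffOn_inChart_of_univ hU hg x
  nonneg z hz := hσ.nonneg (hg.1 _ hz.2)
  zero z hz hz0 := hσ.zero _ ((mem_boundary_iff hz.1).2 hz0) _ (hg.1 _ hz.2)
  unit z hz hz0 := by
    have h1 : IsManifold (𝓡∂ (n + 1)) 1 M := IsManifold.of_le (n := ∞) (by simp)
    obtain ⟨gp, hgp⟩ := hσ.exists_metric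
    have hU' := hU.inter ((𝓡∂ (n + 1)).isOpen_interior (M := M) one_ne_zero)
    have hg' := hg.mono (inter_subset_left (t := (𝓡∂ (n + 1)).interior M))
    have hz' : z ∈ chartDomain (U ∩ (𝓡∂ (n + 1)).interior M) x :=
      ⟨hz.1, hz.2, (mem_interior_iff hz.1).2 hz0⟩
    have hpos : ∀ z ∈ chartDomain (U ∩ (𝓡∂ (n + 1)).interior M) x, 0 < σ.inChart g x z :=
      fun z hz => hσ.pos _ hz.2.2 _ (hg.1 _ hz.2.1)
    -- The scattering identity for σ itself: weight one, represented by 1 in the scale g₊. The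
    -- Laplacian of 1 vanishes and w(n+w) = n + 1.
    have h := hσ.scattering hn hgp hU' inter_subset_right hg' x (w := 1) (f' := fun _ => 1)
      (σ.contDiffOn_inChart_of_univ hU' hg' x) (fun z hz => by
        rw [Real.rpow_one, inv_mul_cancel₀ (hpos z hz).ne']) hz'
    have hlap : laplacian (metricMat gp x) (fun _ _ _ => 0) (fun _ => (1 : ℝ)) z = 0 := by
      rw [laplacian_eq_neg_divergence]
      have : differential (fun _ : Model n => (1 : ℝ)) = fun _ _ => 0 := by
        funext z i
        exact pd_const _ _
      simp [this, divergence, covCovector, pd_const]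
    rw [hlap, Real.rpow_one, zero_add, one_mul, mul_one] at h
    exact mul_left_cancel₀ (hpos z hz').ne' h

end Scattering

end ScalesInChart

end

end PoincareEinstein

/-! ### Assembly of the invariance, scattering and Robin statements. -/

theorem mainTheorem6 {n : ℕ} (hn : 3 ≤ n) {M : Type*} [TopologicalSpace M] [T2Space M]
    [CompactSpace M] [ChartedSpace (EuclideanHalfSpace (n + 1)) M]
    [IsManifold (𝓡∂ (n + 1)) ∞ M] (c : PoincareEinstein.ConformalStructure n M)
    (σ : PoincareEinstein.Density c univ 1) (hσ : PoincareEinstein.IsPoincareEinstein c σ)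
    (w s : ℝ) (hs : s = n + w) :
    -- conformal invariance of `D_A` and of `I^A D_A` on densities of weight `w`
    (∀ (U : Set M), IsOpen U → ∀ (u : PoincareEinstein.Density c U w)
        (g g' : ∀ p : M, PoincareEinstein.Bil n p),
        PoincareEinstein.IsScaleOn c U g → PoincareEinstein.IsScaleOn c U g' →
        ∀ Ω : M → ℝ, (∀ p ∈ U, 0 < Ω p ∧ g' p = (Ω p) ^ 2 • g p) →
        ∀ x : M, ∀ p ∈ U ∩ (extChartAt (𝓡∂ (n + 1)) x).source,
        ∀ y, y = extChartAt (𝓡∂ (n + 1)) x p →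
          PoincareEinstein.thomasD (PoincareEinstein.metricMat g' x) (fun _ _ _ => 0) w
              (u.inChart g' x) y
            = (Ω p) ^ (w - 1) • PoincareEinstein.tractorChange (PoincareEinstein.metricMat g x y)
                (Ω p)
                (fun a => PoincareEinstein.pd a
                  (fun z => Real.log (Ω ((extChartAt (𝓡∂ (n + 1)) x).symm z))) y)
                (PoincareEinstein.thomasD (PoincareEinstein.metricMat g x) (fun _ _ _ => 0) w
                  (u.inChart g x) y) ∧
          PoincareEinstein.scaleDotD (PoincareEinstein.metricMat g' x) (σ.inChart g' x)
              (fun _ _ _ => 0) w (u.inChart g' x) y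
            = (Ω p) ^ (w - 1) * PoincareEinstein.scaleDotD (PoincareEinstein.metricMat g x)
                (σ.inChart g x) (fun _ _ _ => 0) w (u.inChart g x) y) ∧
    -- the scattering Laplacian on the interior: an equality of densities of weight `w`, evaluated
    -- in an arbitrary scale `g`, in which `σ ^ w` is the factor from the scale `g₊` to `g`
    (∀ gp : ∀ p : M, PoincareEinstein.Bil n p,
        PoincareEinstein.IsMetricOf σ ((𝓡∂ (n + 1)).interior M) gp →
        ∀ (U : Set M), IsOpen U → ∀ (u : PoincareEinstein.Density c U w)
        (g : ∀ p : M, PoincareEinstein.Bil n p), PoincareEinstein.IsScaleOn c U g →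
        ∀ x : M, ∀ p ∈ U ∩ (𝓡∂ (n + 1)).interior M ∩ (extChartAt (𝓡∂ (n + 1)) x).source,
        ∀ y, y = extChartAt (𝓡∂ (n + 1)) x p →
          σ.inScale g p * PoincareEinstein.scaleDotD (PoincareEinstein.metricMat g x)
              (σ.inChart g x) (fun _ _ _ => 0) w (u.inChart g x) y
            = (σ.inScale g p) ^ w *
              (PoincareEinstein.laplacian (PoincareEinstein.metricMat gp x) (fun _ _ _ => 0)
                  (u.inChart gp x) y
                - s * (n - s) * u.inScale gp p)) ∧
    -- the Robin operator along the boundary, on densities of weight `w`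
    (∀ (U : Set M), IsOpen U → ∀ (u : PoincareEinstein.Density c U w)
        (g : ∀ p : M, PoincareEinstein.Bil n p), PoincareEinstein.IsScaleOn c U g →
        ∀ x : M, ∀ p ∈ U ∩ (𝓡∂ (n + 1)).boundary M ∩ (extChartAt (𝓡∂ (n + 1)) x).source,
        ∀ y, y = extChartAt (𝓡∂ (n + 1)) x p →
        ∀ ν, PoincareEinstein.IsUnitConormalNear (PoincareEinstein.metricMat g x) ν y →
          PoincareEinstein.scaleDotD (PoincareEinstein.metricMat g x) (σ.inChart g x)
              (fun _ _ _ => 0) w (u.inChart g x) y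
            = ((n : ℝ) + 1 + 2 * w - 2) *
              PoincareEinstein.robin (PoincareEinstein.metricMat g x) (fun _ _ _ => 0) w ν
                (u.inChart g x) y) ∧
    -- the Robin operator along the boundary, on tractors `V^{A₁ ⋯ A_k}` of weight `w`, given by
    -- their components in a scale and a chart
    (∀ (U : Set M), IsOpen U → ∀ (g : ∀ p : M, PoincareEinstein.Bil n p),
        PoincareEinstein.IsScaleOn c U g →
        ∀ x : M, ∀ p ∈ U ∩ (𝓡∂ (n + 1)).boundary M ∩ (extChartAt (𝓡∂ (n + 1)) x).source,
        ∀ y, y = extChartAt (𝓡∂ (n + 1)) x p →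
        ∀ ν, PoincareEinstein.IsUnitConormalNear (PoincareEinstein.metricMat g x) ν y →
        ∀ (k : ℕ) (V : PoincareEinstein.Model n → (Fin k → PoincareEinstein.TIdx n) → ℝ),
        (∀ᶠ z in 𝓝[range (𝓡∂ (n + 1))] y,
          ContDiffWithinAt ℝ ∞ V (range (𝓡∂ (n + 1))) z) →
          PoincareEinstein.scaleDotD (PoincareEinstein.metricMat g x) (σ.inChart g x)
              (PoincareEinstein.tensorForm k (PoincareEinstein.metricMat g x)) w V y
            = ((n : ℝ) + 1 + 2 * w - 2) •
              PoincareEinstein.robin (PoincareEinstein.metricMat g x)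
                (PoincareEinstein.tensorForm k (PoincareEinstein.metricMat g x)) w ν V y) := by
  have hn0 : n ≠ 0 := by omega
  have h1 : IsManifold (𝓡∂ (n + 1)) 1 M := IsManifold.of_le (n := ∞) (by simp)
  refine ⟨?_, ?_, ?_, ?_⟩
  · rintro U hU u g g' hg hg' Ω hΩ x p hp y rfl
    have hy := PoincareEinstein.mem_chartDomain hp
    have hc := PoincareEinstein.isConformalOn_metricMat hU hg hΩ x
      (PoincareEinstein.contDiffOn_logFactor hU hg hg' hΩ x)
    have hf := u.contDiffOn_inChart hg x
    have hf' := fun z hz => u.inChart_eq hg hΩ x (z := z) hz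
    have hs := σ.contDiffOn_inChart_of_univ hU hg x
    have hlog : PoincareEinstein.logFactor Ω x (extChartAt (𝓡∂ (n + 1)) x p)
        = Real.log (Ω p) := by
      rw [PoincareEinstein.logFactor, (extChartAt (𝓡∂ (n + 1)) x).left_inv hp.2]
    have hs' : ∀ z ∈ PoincareEinstein.chartDomain U x, σ.inChart g' x z
        = Real.exp (PoincareEinstein.logFactor Ω x z) * σ.inChart g x z := fun z hz => by
      obtain ⟨e0, e1⟩ := hΩ _ hz.2
      rw [PoincareEinstein.logFactor, Real.exp_log e0, PoincareEinstein.Density.inChart,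
        σ.inScale_eq (mem_univ _) (hg.1 _ hz.2) e0 e1, Real.rpow_one]
      rfl
    have hpow : Real.exp ((w - 1) * Real.log (Ω p)) = Ω p ^ (w - 1) := by
      rw [Real.rpow_def_of_pos (hΩ p hp.1).1, mul_comm]
    constructor
    · rw [hc.thomasD_eq hn0 hf hf' hy, hlog, hpow, Real.exp_log (hΩ p hp.1).1]
      rfl
    · rw [hc.scaleDotD_eq hn0 hs hs' hf hf' hy, hlog, hpow]
  · rintro gp hgp U hU u g hg x p hp y rfl
    have hU' := hU.inter ((𝓡∂ (n + 1)).isOpen_interior (M := M) one_ne_zero)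
    have hg' := hg.mono (inter_subset_left (t := (𝓡∂ (n + 1)).interior M))
    have hy := PoincareEinstein.mem_chartDomain hp
    have hf := (u.contDiffOn_inChart hg x).mono
      (fun z (hz : z ∈ PoincareEinstein.chartDomain (U ∩ (𝓡∂ (n + 1)).interior M) x) =>
        ⟨hz.1, hz.2.1⟩)
    have h := hσ.scattering hn0 hgp hU' inter_subset_right hg' x hf (w := w)
      (f' := u.inChart gp x) (fun z hz => ?_) hy
    -- Since s = n + w, n - s = -w, so -s(n-s) is the constant w(n+w) of the chart computation.
    · simp only [PoincareEinstein.Density.inChart,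
        (extChartAt (𝓡∂ (n + 1)) x).left_inv hp.2] at h ⊢
      rw [h, hs]
      ring
    · have hpos : 0 < σ.inScale g ((extChartAt (𝓡∂ (n + 1)) x).symm z) :=
        hσ.pos _ hz.2.2 _ (hg.1 _ hz.2.1)
      obtain ⟨e1, e2⟩ := hgp _ hz.2.2
      -- The condition that σ be 1 in the scale g₊ forces t = σ⁻¹, which is the factor by which u
      -- changes.
      obtain ⟨t, ht, e3⟩ := c.exists_factor (hg.1 _ hz.2.1) e1
      rw [σ.inScale_eq (Ω := fun _ => t) (mem_univ _) (hg.1 _ hz.2.1) ht e3, Real.rpow_one] at e2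
      unfold PoincareEinstein.Density.inChart
      rw [u.inScale_eq (Ω := fun _ => t) hz.2.1 (hg.1 _ hz.2.1) ht e3,
        eq_inv_of_mul_eq_one_left e2]
  · rintro U hU u g hg x p hp y rfl ν hν
    have hy := PoincareEinstein.mem_chartDomain ⟨hp.1.1, hp.2⟩
    refine (hσ.isUnitDefining hn0 hU hg x).scaleDotD_eq_robin hn0 hy ?_ hν _ w _
    refine (PoincareEinstein.mem_boundary_iff hy.1).1 ?_
    rw [(extChartAt (𝓡∂ (n + 1)) x).left_inv hp.2]
    exact hp.1.2
  · rintro U hU g hg x p hp y rfl ν hν k V -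
    have hy := PoincareEinstein.mem_chartDomain ⟨hp.1.1, hp.2⟩
    refine (hσ.isUnitDefining hn0 hU hg x).scaleDotD_eq_robin hn0 hy ?_ hν _ w _
    refine (PoincareEinstein.mem_boundary_iff hy.1).1 ?_
    rw [(extChartAt (𝓡∂ (n + 1)) x).left_inv hp.2]
    exact hp.1.2
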